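/- Fix constants $\lambda>0$ (intensity), $P>0$ (transmit power), $\eta>2$ (path-loss exponent) and $r_0>0$ (exclusion radius), and a constellation $s_1,\dots,s_M\in\mathbb{C}$ of unit power, $\frac1M\sum_{m=1}^M|s_m|^2=1$; for a uniformly chosen symbol $s$ write $\mathbb{E}\{|s|^n\}=\frac1M\sum_{m=1}^M|s_m|^n$. Let $x_1,x_2,\dots$ be the points, enumerated by increasing distance from the origin, of a Poisson point process in $\mathbb{R}^2$ with intensity measure $\lambda\,\mathbf 1_{\{\|x\|>r_0\}}\,dx$. Let $\sigma_1,\sigma_2,\dots$ be random symbols, each uniformly distributed on the constellation (with index $m$ uniform on $\{1,\dots,M\}$), and let $h_1,h_2,\dots$ be $\mathcal{CN}(0,1)$ variables (circularly symmetric complex Gaussian with mean $0$ and $\mathbb{E}|h_k|^2=1$), all $\sigma_k$ and $h_k$ being mutually independent and independent of the point process. Then the series $$ i_{agg}=\sum_{k\ge1}\sqrt P\,\sigma_k h_k\|x_k\|^{-\eta/2}, $$ summed in the order of increasing distance, converges almost surely, and its sum, the aggregate baseband interference, has the following properties. (1) $i_{agg}$ is circularly symmetric: $u\,i_{agg}$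 has the same law as $i_{agg}$ for every $u\in\mathbb{C}$ with $|u|=1$. (2) For every $\omega\in\mathbb{C}$ the characteristic function $\varphi(\omega)=\mathbb{E}\,e^{\jmath\,\mathrm{Re}(\bar\omega\, i_{agg})}$ is $$\varphi(\omega)=\exp\Big\{\frac{\pi\lambda}{M}\sum_{m=1}^M r_0^2\Big[1-{}_1F_1\Big(-\tfrac2\eta;\,1-\tfrac2\eta;\,-\frac{|\omega|^2P|s_m|^2}{4r_0^\eta}\Big)\Big]\Big\} =\exp\Big\{2\pi\lambda r_0^2\sum_{k=1}^\infty\frac{(-1)^k|\omega|^{2k}\,\mathbb{E}\{|s|^{2k}\}}{(\eta k-2)\,k!}\Big(\frac{P}{4r_0^\eta}\Big)^k\Big\},$$ where the last series converges and ${}_1F_1(a;b;z)=\sum_{n\ge0}\frac{a(a+1)\cdots(a+n-1)}{b(b+1)\cdots(b+n-1)}\frac{z^n}{n!}$ is Kummer's function. (3) For $X=\mathrm{Re}\,i_{agg}$ and for $X=\mathrm{Im}\,i_{agg}$ the function $t\mapsto\ln\mathbb{E}e^{\jmath tX}$ is smooth near $0$, and the cumulants $\kappa_n(X)=\jmath^{-n}\frac{d^n}{dt^n}\ln\mathbb{E}e^{\jmath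 tX}\big|_{t=0}$, $n\ge1$, are $$\kappa_n(X)=0\ \ (n\text{ odd}),\qquad \kappa_n(X)=\frac{\pi\lambda P^{n/2}}{2^{n-1}\left(\frac{\eta n}{2}-2\right)}\cdot\frac{n!}{(n/2)!}\;r_0^{\,2-\frac{\eta n}{2}}\;\mathbb{E}\{|s|^n\}\ \ (n\text{ even}).$$ (4) The expected power is finite and $\displaystyle\mathbb{E}\{|i_{agg}|^2\}=\frac{2\pi\lambda P\,r_0^{2-\eta}}{\eta-2}$. -/

import Mathlib

open MeasureTheory ProbabilityTheory Filter Topology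
open scoped Nat

/-- The Euclidean plane in which the transmitters are located; the receiver is at the origin. -/
abbrev Plane : Type := EuclideanSpace ℝ (Fin 2)

/-- The number (possibly `∞`) of points of the random sequence `x` that lie in `B`. -/
noncomputable def pointCount {Ω : Type*} (x : ℕ → Ω → Plane) (B : Set Plane) (ω : Ω) : ℕ∞ :=
  Set.encard {k : ℕ | x k ω ∈ B}

/-- The random points `x 0, x 1, …` are an enumeration of a Poisson point process in the plane
with intensity measure `Λ`: the number of points in a bounded Borel set `B` is Poisson with mean
`Λ B`, and the numbers of points in finitely many disjoint Borel sets are independent. -/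
structure IsPoissonPointProcess {Ω : Type*} [MeasurableSpace Ω] (μ : Measure Ω)
    (Λ : Measure Plane) (x : ℕ → Ω → Plane) : Prop where
  measurable : ∀ k, Measurable (x k)
  hasLaw_count : ∀ B : Set Plane, MeasurableSet B → Bornology.IsBounded B →
    HasLaw (pointCount x B) ((poissonMeasure (Λ B).toNNReal).map (Nat.cast : ℕ → ℕ∞)) μ
  indep_count : ∀ (m : ℕ) (B : Fin m → Set Plane), (∀ i, MeasurableSet (B i)) →
    Pairwise (Function.onFun Disjoint B) → iIndepFun (fun i => pointCount x (B i)) μ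

/-- The intensity measure `lam dx` on the exterior `‖x‖ > r₀` of the exclusion disc. -/
noncomputable def exteriorIntensity (lam r₀ : ℝ) : Measure Plane :=
  ENNReal.ofReal lam • (volume : Measure Plane).restrict {y : Plane | r₀ < ‖y‖}

/-- The law of an equiprobable symbol of the constellation `c 0, …, c (M - 1)`. -/
noncomputable def symbolLaw {M : ℕ} (c : Fin M → ℂ) : Measure ℂ :=
  (uniformOn (Set.univ : Set (Fin M))).map c

/-- The moment `𝔼 |s| ^ n` of an equiprobable symbol `s` of the constellation `c`. -/
noncomputable def symbolMoment {M : ℕ} (c : Fin M → ℂ) (n : ℕ) : ℝ :=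
  ∫ z, ‖z‖ ^ n ∂(symbolLaw c)

/-- The circularly symmetric complex Gaussian law `𝒞𝒩(0, 1)`: real and imaginary parts are
independent centred Gaussian variables of variance `1 / 2`. -/
noncomputable def stdComplexGaussian : Measure ℂ :=
  ((gaussianReal 0 (1 / 2)).prod (gaussianReal 0 (1 / 2))).map
    (fun p : ℝ × ℝ => (p.1 : ℂ) + (p.2 : ℂ) * Complex.I)

/-- The interference of the first `N` interferers,
`∑_{k < N} √P * s_k * h_k * ‖x_k‖ ^ (-η / 2)`. -/
noncomputable def partialInterference {Ω : Type*} (P η : ℝ) (x : ℕ → Ω → Plane)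
    (s h : ℕ → Ω → ℂ) (N : ℕ) (ω : Ω) : ℂ :=
  ∑ k ∈ Finset.range N, ((√P : ℝ) : ℂ) * s k ω * h k ω * ((‖x k ω‖ ^ (-(η / 2)) : ℝ) : ℂ)

/-- The aggregate interference `∑_k √P * s_k * h_k * ‖x_k‖ ^ (-η / 2)`, summed in the order of
the enumeration (for `η ≤ 4` the series need not converge absolutely). -/
noncomputable def aggregateInterference {Ω : Type*} (P η : ℝ) (x : ℕ → Ω → Plane)
    (s h : ℕ → Ω → ℂ) (ω : Ω) : ℂ :=
  limUnder atTop (fun N => partialInterference P η x s h N ω)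

/-- Kummer's confluent hypergeometric function `₁F₁(a; b; z) = ∑ (a)_n / (b)_n * z ^ n / n!`,
with rising factorials `(a)_n = a (a + 1) ⋯ (a + n - 1)`. -/
noncomputable def kummer (a b z : ℝ) : ℝ :=
  ∑' n : ℕ, (ascPochhammer ℝ n).eval a / (ascPochhammer ℝ n).eval b * (z ^ n / (n ! : ℝ))

/-- The logarithm `t ↦ ln 𝔼 exp(i t X)` of the characteristic function of a real random variable
(principal branch, hence the continuous logarithm vanishing at `0` for `t` near `0`). -/
noncomputable def logCharFun {Ω : Type*} [MeasurableSpace Ω] (μ : Measure Ω) (X : Ω → ℝ)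
    (t : ℝ) : ℂ :=
  Complex.log (charFun (μ.map X) t)

/-- The `n`-th cumulant `i⁻ⁿ (d/dt)ⁿ ln 𝔼 exp(i t X)` at `t = 0` of a real random variable. -/
noncomputable def cumulant {Ω : Type*} [MeasurableSpace Ω] (μ : Measure Ω) (X : Ω → ℝ)
    (n : ℕ) : ℂ :=
  iteratedDeriv n (logCharFun μ X) 0 / Complex.I ^ n

/-! Freeze the locations. The interference is then a series of independent centred marks `s k * h k`
with deterministic weights `pathGain`. By Campbell's theorem (`sum_map_eq`) the squared weights are
almost surely summable, because `‖y‖ ^ (-η)` is integrable over the exterior of the disc exactly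
when `η > 2`. Kolmogorov's one-series theorem then gives convergence, and Fubini on the product law
(`IndepFun.ae_of_ae_ae`) returns it to random locations.

A mark has the radial, positive characteristic function ψ = `fadedCharFun`, so the partial sums
have, given the locations, the characteristic function `∏ ψ(pathGain * ‖w‖) = exp(-∑ f (x k))` with
`f = -log ψ`. Jensen's inequality and unit power give `0 ≤ -log ψ(r) ≤ r² / 4`, so `f` is
integrable. The Laplace functional of the Poisson process (`integral_exp_neg_tsum`) turns the limit
into `exp(-∫ (1 - ψ) dΛ)`. Polar coordinates and termwise integration of the exponential series
(`integral_mul_one_sub_exp`) identify the exponent with Kummer's function, whose coefficients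
telescope.

The other claims are read off this formula. It depends on `‖w‖` only, hence circular symmetry. Its
logarithm is an everywhere convergent even power series, hence the cumulants. It is `1 - O(t²)` on
each axis, which forces a finite second moment, and the second derivative at `0` gives its value. -/

/-! ### Almost sure convergence of independent centred series -/

/-- Kolmogorov's one-series theorem, for strongly measurable summands. -/
theorem ae_exists_tendsto_sum_of_stronglyMeasurable {Ω : Type*} [MeasurableSpace Ω]
    {μ : Measure Ω} [IsProbabilityMeasure μ] {Y : ℕ → Ω → ℝ}
    (hm : ∀ k, StronglyMeasurable (Y k)) (hY : ∀ k, MemLp (Y k) 2 μ) (hind : iIndepFun Y μ)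
    (h0 : ∀ k, ∫ ω, Y k ω ∂μ = 0) (hs : Summable fun k => Var[Y k; μ]) :
    ∀ᵐ ω ∂μ, ∃ l : ℝ, Tendsto (fun N => ∑ k ∈ Finset.range N, Y k ω) atTop (𝓝 l) := by
  -- The sum includes the index `n`, so that `S n` is adapted to the natural filtration at time `n`;
  -- the shift is undone at the end.
  set S : ℕ → Ω → ℝ := fun n => ∑ k ∈ Finset.range (n + 1), Y k with hS
  have hSL : ∀ n, MemLp (S n) 2 μ := fun n => memLp_finsetSum' _ fun k _ => hY k
  have hmart : Martingale S (Filtration.natural Y hm) μ := by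
    refine martingale_of_condExp_sub_eq_zero_nat ?_ (fun n => (hSL n).integrable (by norm_num)) ?_
    · intro n
      refine Finset.stronglyMeasurable_sum _ fun k hk => ?_
      exact (Filtration.stronglyAdapted_natural hm k).mono
        ((Filtration.natural Y hm).mono (Nat.lt_succ_iff.1 (Finset.mem_range.1 hk)))
    · intro n
      have h1 : S (n + 1) - S n = Y (n + 1) := by
        simp only [hS, Finset.sum_range_succ _ (n + 1), add_sub_cancel_left]
      rw [h1]
      refine (hind.condExp_natural_ae_eq_of_lt hm (Nat.lt_succ_self n)).trans ?_
      simp only [h0]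
      rfl
  have hvar : ∀ n, Var[S n; μ] ≤ ∑' k, Var[Y k; μ] := by
    intro n
    rw [hS, IndepFun.variance_sum (fun k _ => hY k) (fun i _ j _ hij => hind.indepFun hij)]
    exact hs.sum_le_tsum _ fun k _ => variance_nonneg _ _
  have hmean : ∀ n, μ[S n] = 0 := by
    intro n
    simp only [hS, Finset.sum_apply]
    rw [integral_finsetSum _ fun k _ => (hY k).integrable (by norm_num)]
    simp [h0]
  -- Martingale convergence asks for an L¹ bound; on a probability space the L² bound from the
  -- summed variances supplies it.
  have hbdd : ∀ n, eLpNorm (S n) 1 μ ≤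
      ((ENNReal.ofReal (∑' k, Var[Y k; μ])) ^ (1 / 2 : ℝ)).toNNReal := by
    intro n
    rw [ENNReal.coe_toNNReal (ENNReal.rpow_ne_top_of_nonneg (by norm_num) ENNReal.ofReal_ne_top)]
    refine (eLpNorm_le_eLpNorm_of_exponent_le (by norm_num : (1 : ENNReal) ≤ 2)
      (hSL n).aestronglyMeasurable).trans ?_
    rw [eLpNorm_eq_lintegral_rpow_enorm_toReal (by norm_num) (by norm_num)]
    refine ENNReal.rpow_le_rpow ?_ (by norm_num)
    rw [← ENNReal.ofReal_toReal (a := ∫⁻ x, _ ∂μ) ?_]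
    · refine ENNReal.ofReal_le_ofReal ((le_of_eq ?_).trans (hvar n))
      rw [variance_of_integral_eq_zero (hSL n).aestronglyMeasurable.aemeasurable (hmean n),
        integral_eq_lintegral_of_nonneg_ae (f := fun ω => S n ω ^ 2)
          (ae_of_all _ fun _ => by positivity)
          ((hSL n).aestronglyMeasurable.pow 2)]
      congr 1
      refine lintegral_congr fun ω => ?_
      rw [← Real.enorm_of_nonneg (by positivity)]
      simp
    · have := (hSL n).eLpNorm_lt_top
      rw [eLpNorm_lt_top_iff_lintegral_rpow_enorm_lt_top (by norm_num) (by norm_num)] at this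
      exact this.ne
  filter_upwards [hmart.submartingale.exists_ae_tendsto_of_bdd hbdd] with ω hω
  obtain ⟨l, hl⟩ := hω
  refine ⟨l, (tendsto_add_atTop_iff_nat 1).1 ?_⟩
  simpa [hS, Finset.sum_apply] using hl

/-- Kolmogorov's one-series theorem. -/
theorem ae_exists_tendsto_sum_of_summable_variance {Ω : Type*} [MeasurableSpace Ω]
    {μ : Measure Ω} [IsProbabilityMeasure μ] {Y : ℕ → Ω → ℝ}
    (hY : ∀ k, MemLp (Y k) 2 μ) (hind : iIndepFun Y μ)
    (h0 : ∀ k, ∫ ω, Y k ω ∂μ = 0) (hs : Summable fun k => Var[Y k; μ]) :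
    ∀ᵐ ω ∂μ, ∃ l : ℝ, Tendsto (fun N => ∑ k ∈ Finset.range N, Y k ω) atTop (𝓝 l) := by
  -- The natural filtration needs strongly measurable functions; modifications on null sets preserve
  -- independence, means and variances.
  have he : ∀ k, Y k =ᵐ[μ] (hY k).1.mk (Y k) := fun k => (hY k).1.ae_eq_mk
  have h := ae_exists_tendsto_sum_of_stronglyMeasurable (μ := μ)
    (fun k => (hY k).1.stronglyMeasurable_mk) (fun k => (hY k).ae_eq (he k))
    ((iIndepFun_congr he).1 hind) (fun k => by rw [← integral_congr_ae (he k), h0 k])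
    (by simpa only [variance_congr (he _)] using hs)
  filter_upwards [h, ae_all_iff.2 he] with ω ⟨l, hl⟩ hω
  exact ⟨l, by simpa only [hω] using hl⟩

/-! ### Laplace transform and mean of the Poisson distribution -/

/-- The Laplace transform of the Poisson distribution. -/
theorem integral_exp_neg_mul_poissonMeasure (r : NNReal) (t : ℝ) :
    ∫ n : ℕ, Real.exp (-(t * n)) ∂(poissonMeasure r) =
      Real.exp (-((1 - Real.exp (-t)) * r)) := by
  rw [integral_poissonMeasure]
  have h := (NormedSpace.expSeries_div_hasSum_exp ((r : ℝ) * Real.exp (-t))).mul_left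
    (Real.exp (-(r : ℝ)))
  rw [← Real.exp_eq_exp_ℝ, ← Real.exp_add] at h
  rw [show -((1 - Real.exp (-t)) * (r : ℝ)) = -(r : ℝ) + r * Real.exp (-t) by ring, ← h.tsum_eq]
  refine tsum_congr fun n => ?_
  rw [mul_pow, ← Real.exp_nat_mul, smul_eq_mul, show (n : ℝ) * -t = -(t * n) by ring]
  ring

/-- The mean of the Poisson distribution. -/
theorem lintegral_natCast_poissonMeasure (r : NNReal) :
    ∫⁻ n : ℕ, (n : ENNReal) ∂(poissonMeasure r) = r := by
  have h : HasSum (fun n : ℕ => Real.exp (-r) * (r : ℝ) ^ n / (n ! : ℝ) * n) r := by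
    -- The zeroth term vanishes, and `(n + 1) / (n + 1)! = 1 / n !` reduces the rest to `r` times
    -- the total mass.
    rw [← hasSum_nat_add_iff' 1]
    simp only [Finset.range_one, Finset.sum_singleton, CharP.cast_eq_zero, mul_zero, sub_zero]
    have h1 := (hasSum_one_poissonMeasure r).mul_left (r : ℝ)
    rw [mul_one] at h1
    have h2 : (fun n : ℕ => Real.exp (-r) * (r : ℝ) ^ (n + 1) / ((n + 1)! : ℝ) * (n + 1 : ℕ)) =
        fun n : ℕ => (r : ℝ) * (Real.exp (-r) * (r : ℝ) ^ n / (n ! : ℝ)) := by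
      funext n
      rw [Nat.factorial_succ]
      push_cast
      field_simp
      ring
    rw [← h2] at h1
    exact h1
  rw [lintegral_countable']
  calc ∑' n : ℕ, (n : ENNReal) * poissonMeasure r {n}
      = ∑' n : ℕ, ENNReal.ofReal (Real.exp (-r) * (r : ℝ) ^ n / (n ! : ℝ) * n) := by
        refine tsum_congr fun n => ?_
        rw [poissonMeasure_singleton, mul_comm, ENNReal.ofReal_mul (by positivity),
          ENNReal.ofReal_natCast]
    _ = r := by
        rw [← ENNReal.ofReal_tsum_of_nonneg (fun n => by positivity) h.summable, h.tsum_eq,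
          ENNReal.ofReal_coe_nnreal]

/-! ### Campbell's theorem and the Laplace functional of a Poisson process -/

section PointProcess

variable {Ω : Type*}

theorem toENNReal_pointCount (x : ℕ → Ω → Plane) (B : Set Plane) (ω : Ω) :
    (pointCount x B ω : ENNReal) = ∑' k, B.indicator (fun _ => (1 : ENNReal)) (x k ω) := by
  rw [pointCount, ← ENNReal.tsum_set_one]
  exact tsum_subtype {k : ℕ | x k ω ∈ B} (fun _ => (1 : ENNReal))

/-- No finiteness is needed: for infinitely many points both sides take the default value `0`. -/
theorem tsum_indicator_const_eq_pointCount (x : ℕ → Ω → Plane) (B : Set Plane) (ω : Ω) (t : ℝ) :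
    ∑' k, B.indicator (fun _ => t) (x k ω) = t * (pointCount x B ω).toNat := by
  have h := tsum_subtype {k : ℕ | x k ω ∈ B} (fun _ => t)
  rw [tsum_const, nsmul_eq_mul] at h
  rw [mul_comm, pointCount]
  exact h.symm

variable [MeasurableSpace Ω] {μ : Measure Ω} {Λ : Measure Plane} {x : ℕ → Ω → Plane}

namespace IsPoissonPointProcess

theorem lintegral_pointCount (hx : IsPoissonPointProcess μ Λ x) {B : Set Plane}
    (hB : MeasurableSet B) (hb : Bornology.IsBounded B) (hΛ : Λ B ≠ ⊤) :
    ∫⁻ ω, (pointCount x B ω : ENNReal) ∂μ = Λ B := by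
  rw [(hx.hasLaw_count B hB hb).lintegral_comp (f := fun n : ℕ∞ => (n : ENNReal))
    (Measurable.of_discrete).aemeasurable, lintegral_map .of_discrete .of_discrete]
  simp only [ENat.toENNReal_coe]
  rw [lintegral_natCast_poissonMeasure, ENNReal.coe_toNNReal hΛ]

theorem integral_exp_neg_pointCount (hx : IsPoissonPointProcess μ Λ x) {B : Set Plane}
    (hB : MeasurableSet B) (hb : Bornology.IsBounded B) (t : ℝ) :
    ∫ ω, Real.exp (-(t * (pointCount x B ω).toNat)) ∂μ =
      Real.exp (-((1 - Real.exp (-t)) * Λ.real B)) := by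
  have h := (hx.hasLaw_count B hB hb).integral_comp
    (f := fun n : ℕ∞ => Real.exp (-(t * n.toNat)))
    (Measurable.of_discrete).aestronglyMeasurable
  rw [Function.comp_def] at h
  rw [h, integral_map .of_discrete (Measurable.of_discrete).aestronglyMeasurable]
  simp only [ENat.toNat_natCast]
  exact integral_exp_neg_mul_poissonMeasure _ t

/-- Campbell's theorem: the mean measure of the process is its intensity measure. -/
theorem sum_map_eq (hx : IsPoissonPointProcess μ Λ x)
    (hΛ : ∀ R : ℕ, Λ (Metric.ball 0 R) ≠ ⊤) : Measure.sum (fun k => μ.map (x k)) = Λ := by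
  -- The law of the counts is prescribed on bounded sets only, so the measures are compared inside
  -- balls first and the balls then exhaust the plane.
  have hbd : ∀ A : Set Plane, MeasurableSet A → ∀ R : ℕ,
      Measure.sum (fun k => μ.map (x k)) (A ∩ Metric.ball 0 R) = Λ (A ∩ Metric.ball 0 R) := by
    intro A hA R
    have hm : MeasurableSet (A ∩ Metric.ball 0 (R : ℝ)) := hA.inter measurableSet_ball
    rw [← hx.lintegral_pointCount hm (Metric.isBounded_ball.subset Set.inter_subset_right)
      (measure_ne_top_of_subset Set.inter_subset_right (hΛ R)), Measure.sum_apply _ hm]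
    simp only [toENNReal_pointCount]
    have hxm : ∀ k, AEMeasurable (fun ω => (A ∩ Metric.ball 0 (R : ℝ)).indicator
        (fun _ => (1 : ENNReal)) (x k ω)) μ := fun k =>
      ((measurable_const.indicator hm).comp (hx.measurable k)).aemeasurable
    rw [lintegral_tsum hxm]
    refine tsum_congr fun k => ?_
    rw [← lintegral_map (measurable_const.indicator hm) (hx.measurable k),
      lintegral_indicator_const hm, one_mul]
  ext A hA
  have hU : A = ⋃ R : ℕ, A ∩ Metric.ball 0 (R : ℝ) := by
    rw [← Set.inter_iUnion, Metric.iUnion_ball_nat, Set.inter_univ]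
  have hmono : Monotone fun R : ℕ => A ∩ Metric.ball (0 : Plane) (R : ℝ) := fun a b hab =>
    Set.inter_subset_inter_right _ (Metric.ball_subset_ball (Nat.cast_le.2 hab))
  rw [hU, hmono.measure_iUnion, hmono.measure_iUnion]
  exact iSup_congr (hbd A hA)

/-- By Tonelli and Campbell, the mean of `∑ ‖f (x k)‖` is the `Λ`-integral of `‖f‖`, which is
finite. -/
theorem ae_summable (hx : IsPoissonPointProcess μ Λ x)
    (hΛ : ∀ R : ℕ, Λ (Metric.ball 0 R) ≠ ⊤) {f : Plane → ℝ} (hm : Measurable f)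
    (hf : Integrable f Λ) : ∀ᵐ ω ∂μ, Summable fun k => f (x k ω) := by
  have hxm : ∀ k, AEMeasurable (fun ω => ‖f (x k ω)‖ₑ) μ := fun k =>
    (hm.comp (hx.measurable k)).enorm.aemeasurable
  have h1 : ∫⁻ ω, ∑' k, ‖f (x k ω)‖ₑ ∂μ ≠ ⊤ := by
    rw [lintegral_tsum fun k => hxm k]
    have : ∫⁻ y, ‖f y‖ₑ ∂Λ = ∑' k, ∫⁻ ω, ‖f (x k ω)‖ₑ ∂μ := by
      conv_lhs => rw [← hx.sum_map_eq hΛ, lintegral_sum_measure]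
      exact tsum_congr fun k => lintegral_map hm.enorm (hx.measurable k)
    rw [← this]
    exact hf.2.ne
  filter_upwards [ae_lt_top' (AEMeasurable.tsum hxm) h1] with ω hω
  refine Summable.of_norm ?_
  have := ENNReal.summable_toReal hω.ne
  simpa using this

theorem aestronglyMeasurable_tsum (hx : IsPoissonPointProcess μ Λ x)
    (hΛ : ∀ R : ℕ, Λ (Metric.ball 0 R) ≠ ⊤) {f : Plane → ℝ} (hm : Measurable f)
    (hf : Integrable f Λ) : AEStronglyMeasurable (fun ω => ∑' k, f (x k ω)) μ := by
  refine aestronglyMeasurable_of_tendsto_ae atTop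
    (f := fun n ω => ∑ k ∈ Finset.range n, f (x k ω)) (fun n => ?_) ?_
  · exact (Finset.measurable_sum _ fun k _ =>
      hm.comp (hx.measurable k)).aestronglyMeasurable
  · filter_upwards [hx.ae_summable hΛ hm hf] with ω hω
    exact hω.hasSum.tendsto_sum_nat

theorem ae_pointCount_ne_top (hx : IsPoissonPointProcess μ Λ x) {B : Set Plane}
    (hB : MeasurableSet B) (hb : Bornology.IsBounded B) :
    ∀ᵐ ω ∂μ, pointCount x B ω ≠ ⊤ := by
  have h := hx.hasLaw_count B hB hb
  refine (h.ae_iff (p := fun n : ℕ∞ => n ≠ ⊤) .of_discrete).2 ?_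
  rw [ae_map_iff .of_discrete (.of_discrete)]
  exact ae_of_all _ fun n => ENat.natCast_ne_top n

/-- The Laplace functional of a Poisson process at a step function. -/
theorem integral_exp_neg_sum_pointCount (hx : IsPoissonPointProcess μ Λ x) {ι : Type*}
    [Fintype ι] {B : ι → Set Plane} (hB : ∀ i, MeasurableSet (B i))
    (hb : ∀ i, Bornology.IsBounded (B i)) (hd : Pairwise (Function.onFun Disjoint B))
    (t : ι → ℝ) :
    ∫ ω, Real.exp (-∑ i, t i * (pointCount x (B i) ω).toNat) ∂μ =
      Real.exp (-∑ i, (1 - Real.exp (-t i)) * Λ.real (B i)) := by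
  have hind : iIndepFun (fun i => pointCount x (B i)) μ := by
    let e := Fintype.equivFin ι
    have := hx.indep_count _ (fun j => B (e.symm j)) (fun j => hB _)
      (fun i j hij => hd (e.symm.injective.ne hij))
    simpa using this.precomp e.injective
  have hind2 := hind.comp (fun i n => Real.exp (-(t i * n.toNat))) fun i => .of_discrete
  have h := hind2.integral_fun_prod_eq_prod_integral fun i =>
    ((Measurable.of_discrete (f := fun n : ℕ∞ => Real.exp (-(t i * n.toNat)))).comp_aemeasurable
      (hx.hasLaw_count _ (hB i) (hb i)).aemeasurable).aestronglyMeasurable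
  simp only [Function.comp_apply] at h
  simp only [← Finset.sum_neg_distrib, Real.exp_sum]
  rw [h]
  exact Finset.prod_congr rfl fun i _ => hx.integral_exp_neg_pointCount (hB i) (hb i) (t i)

/-- The Laplace functional of a Poisson process at a simple function of bounded support. -/
theorem integral_exp_neg_tsum_simpleFunc (hx : IsPoissonPointProcess μ Λ x)
    (hΛ : ∀ R : ℕ, Λ (Metric.ball 0 R) ≠ ⊤) (F : SimpleFunc Plane ℝ) (R : ℕ) :
    ∫ ω, Real.exp (-∑' k, (Metric.ball 0 (R : ℝ)).indicator F (x k ω)) ∂μ =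
      Real.exp (-∫ y, (1 - Real.exp (-(Metric.ball 0 (R : ℝ)).indicator F y)) ∂Λ) := by
  set B : F.range → Set Plane := fun i => F ⁻¹' {(i : ℝ)} ∩ Metric.ball 0 (R : ℝ) with hBdef
  have hB : ∀ i, MeasurableSet (B i) := fun i =>
    (F.measurableSet_fiber _).inter measurableSet_ball
  have hb : ∀ i, Bornology.IsBounded (B i) := fun i =>
    Metric.isBounded_ball.subset Set.inter_subset_right
  have hd : Pairwise (Function.onFun Disjoint B) := by
    intro i j hij
    refine Set.disjoint_left.2 fun y hi hj => hij (Subtype.ext ?_)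
    exact hi.1.symm.trans hj.1
  -- On the fibres of `F` inside the ball everything is constant, and `g 0 = 0` takes care of the
  -- outside. This is used for `1 - exp(-u)` in the intensity integral and for the identity in the
  -- random sum.
  have hrep : ∀ (g : ℝ → ℝ), g 0 = 0 → ∀ y, g ((Metric.ball 0 (R : ℝ)).indicator F y) =
      ∑ i : F.range, (B i).indicator (fun _ => g i) y := by
    intro g hg y
    by_cases hy : y ∈ Metric.ball (0 : Plane) (R : ℝ)
    · rw [Set.indicator_of_mem hy, Finset.sum_eq_single ⟨F y, F.mem_range_self y⟩]
      · exact (Set.indicator_of_mem (s := B ⟨F y, F.mem_range_self y⟩) ⟨rfl, hy⟩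
          fun _ => g (F y)).symm
      · intro i _ hi
        exact Set.indicator_of_notMem (s := B i) (fun h => hi (Subtype.ext h.1.symm)) fun _ => g i
      · simp
    · rw [Set.indicator_of_notMem hy, hg]
      exact (Finset.sum_eq_zero fun i _ => Set.indicator_of_notMem (s := B i)
        (fun h => hy h.2) fun _ => g i).symm
  have h := hx.integral_exp_neg_sum_pointCount hB hb hd (fun i => (i : ℝ))
  have hR : ∫ y, (1 - Real.exp (-(Metric.ball 0 (R : ℝ)).indicator F y)) ∂Λ =
      ∑ i : F.range, (1 - Real.exp (-(i : ℝ))) * Λ.real (B i) := by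
    have h2 := hrep (fun u => 1 - Real.exp (-u)) (by simp)
    simp only [h2]
    rw [integral_finsetSum]
    · refine Finset.sum_congr rfl fun i _ => ?_
      rw [integral_indicator_const _ (hB i), smul_eq_mul, mul_comm]
    · intro i _
      refine (integrable_indicator_iff (hB i)).2 (integrableOn_const ?_ (by simp))
      exact measure_ne_top_of_subset Set.inter_subset_right (hΛ R)
  rw [hR, ← h]
  refine integral_congr_ae ?_
  filter_upwards [ae_all_iff.2 fun i => hx.ae_pointCount_ne_top (hB i) (hb i)] with ω hω
  have h3 := hrep (fun u => u) rfl
  simp only [h3]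
  rw [Summable.tsum_finsetSum]
  · simp only [tsum_indicator_const_eq_pointCount]
  · intro i _
    -- Almost surely each bounded cell holds finitely many points, which permits exchanging the two
    -- sums.
    have hfin : {k : ℕ | x k ω ∈ B i}.Finite := Set.encard_ne_top_iff.1 (hω i)
    refine summable_of_hasFiniteSupport (hfin.subset fun k hk => ?_)
    by_contra hk'
    exact hk (Set.indicator_of_notMem (s := B i) (a := x k ω) hk' _)

end IsPoissonPointProcess

/-- A nonnegative measurable function is a pointwise limit from below of simple functions of
bounded support. -/
theorem exists_tendsto_simpleFunc_ball {f : Plane → ℝ} (hm : Measurable f) (h0 : ∀ y, 0 ≤ f y) :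
    ∃ F : ℕ → SimpleFunc Plane ℝ,
      (∀ (n : ℕ) y, 0 ≤ (Metric.ball 0 (n : ℝ)).indicator (F n) y) ∧
      (∀ (n : ℕ) y, (Metric.ball 0 (n : ℝ)).indicator (F n) y ≤ f y) ∧
      ∀ y, Tendsto (fun n : ℕ => (Metric.ball 0 (n : ℝ)).indicator (F n) y) atTop (𝓝 (f y)) := by
  set g : Plane → ENNReal := fun y => ENNReal.ofReal (f y) with hg
  have hgm : Measurable g := hm.ennreal_ofReal
  refine ⟨fun n => (SimpleFunc.eapprox g n).map ENNReal.toReal, fun n y => ?_, fun n y => ?_,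
    fun y => ?_⟩
  · exact Set.indicator_nonneg (fun _ _ => ENNReal.toReal_nonneg) _
  · refine Set.indicator_le' (g := f) (fun y _ => ?_) (fun y _ => h0 y) y
    refine ENNReal.toReal_le_of_le_ofReal (h0 y) ?_
    change _ ≤ g y
    rw [← SimpleFunc.iSup_eapprox_apply hgm y]
    exact le_iSup (fun n => SimpleFunc.eapprox g n y) n
  · have h1 : Tendsto (fun n : ℕ => ((SimpleFunc.eapprox g n) y).toReal) atTop (𝓝 (f y)) := by
      have := (ENNReal.tendsto_toReal (a := g y) ENNReal.ofReal_ne_top).comp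
        (SimpleFunc.tendsto_eapprox hgm y)
      rwa [hg, ENNReal.toReal_ofReal (h0 y)] at this
    refine h1.congr' ?_
    obtain ⟨N, hN⟩ := exists_nat_gt ‖y‖
    filter_upwards [eventually_ge_atTop N] with n hn
    rw [Set.indicator_of_mem]
    · rfl
    · rw [mem_ball_zero_iff]
      exact hN.trans_le (Nat.cast_le.2 hn)

/-- The Laplace functional of a Poisson point process. -/
theorem IsPoissonPointProcess.integral_exp_neg_tsum [IsProbabilityMeasure μ]
    (hx : IsPoissonPointProcess μ Λ x)
    (hΛ : ∀ R : ℕ, Λ (Metric.ball 0 R) ≠ ⊤) {f : Plane → ℝ} (hm : Measurable f)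
    (h0 : ∀ y, 0 ≤ f y) (hf : Integrable f Λ) :
    ∫ ω, Real.exp (-∑' k, f (x k ω)) ∂μ = Real.exp (-∫ y, (1 - Real.exp (-f y)) ∂Λ) := by
  obtain ⟨F, hF0, hFf, hF⟩ := exists_tendsto_simpleFunc_ball hm h0
  have hFm : ∀ n : ℕ, Measurable ((Metric.ball (0 : Plane) (n : ℝ)).indicator (F n)) := fun n =>
    (F n).measurable.indicator measurableSet_ball
  have hFi : ∀ n : ℕ, Integrable ((Metric.ball (0 : Plane) (n : ℝ)).indicator (F n)) Λ := fun n =>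
    hf.mono' (hFm n).aestronglyMeasurable (ae_of_all _ fun y => by
      rw [Real.norm_of_nonneg (hF0 n y)]; exact hFf n y)
  have hL : Tendsto (fun n : ℕ => ∫ ω, Real.exp
      (-∑' k, (Metric.ball 0 (n : ℝ)).indicator (F n) (x k ω)) ∂μ) atTop
      (𝓝 (∫ ω, Real.exp (-∑' k, f (x k ω)) ∂μ)) := by
    refine tendsto_integral_of_dominated_convergence (fun _ => 1)
      (fun n => Real.continuous_exp.comp_aestronglyMeasurable
        (hx.aestronglyMeasurable_tsum hΛ (hFm n) (hFi n)).neg) (integrable_const _)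
      (fun n => ae_of_all _ fun ω => ?_) ?_
    · rw [Real.norm_of_nonneg (Real.exp_nonneg _), Real.exp_le_one_iff, neg_nonpos]
      exact tsum_nonneg fun k => hF0 n _
    · filter_upwards [hx.ae_summable hΛ hm hf] with ω hω
      refine (Real.continuous_exp.tendsto _).comp (Tendsto.neg ?_)
      refine tendsto_tsum_of_dominated_convergence hω (fun k => hF (x k ω)) ?_
      exact Eventually.of_forall fun n k => by
        rw [Real.norm_of_nonneg (hF0 n _)]; exact hFf n _
  have hR : Tendsto (fun n : ℕ => ∫ ω, Real.exp
      (-∑' k, (Metric.ball 0 (n : ℝ)).indicator (F n) (x k ω)) ∂μ) atTop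
      (𝓝 (Real.exp (-∫ y, (1 - Real.exp (-f y)) ∂Λ))) := by
    simp only [hx.integral_exp_neg_tsum_simpleFunc hΛ]
    refine (Real.continuous_exp.tendsto _).comp (Tendsto.neg ?_)
    refine tendsto_integral_of_dominated_convergence f
      (fun n => (measurable_const.sub (hFm n).neg.exp).aestronglyMeasurable) hf
      (fun n => ae_of_all _ fun y => ?_) (ae_of_all _ fun y => ?_)
    -- Domination by `f`: with `F` the truncated simple function, `0 ≤ 1 - exp(-F) ≤ F ≤ f`.
    · have h1 := Real.add_one_le_exp (-(Metric.ball (0 : Plane) (n : ℝ)).indicator (F n) y)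
      have h2 : Real.exp (-(Metric.ball (0 : Plane) (n : ℝ)).indicator (F n) y) ≤ 1 := by
        rw [Real.exp_le_one_iff, neg_nonpos]; exact hF0 n y
      rw [Real.norm_of_nonneg (by linarith)]
      linarith [hFf n y]
    · exact tendsto_const_nhds.sub ((Real.continuous_exp.tendsto _).comp (hF y).neg)
  exact tendsto_nhds_unique hL hR

end PointProcess

/-! ### Grouping and freezing independent variables -/

/-- Independent random variables stay independent when they are grouped along a product index. -/
theorem ProbabilityTheory.iIndepFun.curry {Ω ι κ E : Type*} [MeasurableSpace Ω]
    [MeasurableSpace E] [Countable ι] [Countable κ] {μ : Measure Ω} {X : ι × κ → Ω → E}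
    (h : iIndepFun X μ) (hX : ∀ p, AEMeasurable (X p) μ) :
    iIndepFun (fun i ω j => X (i, j) ω) μ := by
  have := h.isProbabilityMeasure
  have : ∀ p, IsProbabilityMeasure (μ.map (X p)) := fun p =>
    Measure.isProbabilityMeasure_map (hX p)
  -- Independence means that the joint law is the product of the marginals; currying turns a product
  -- over pairs into a product of products.
  rw [iIndepFun_iff_map_fun_eq_infinitePi_map₀' fun i => aemeasurable_pi_iff.2 fun j => hX (i, j)]
  have h1 : ∀ i, μ.map (fun ω j => X (i, j) ω) = Measure.infinitePi fun j => μ.map (X (i, j)) :=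
    fun i => (h.precomp (g := fun j => (i, j)) (fun a b hab => by simpa using hab)
      ).map_fun_eq_infinitePi_map₀' fun j => hX (i, j)
  simp only [h1]
  have h2 := Measure.infinitePi_map_curry (X := E) (fun (i : ι) (j : κ) => μ.map (X (i, j)))
  rw [← h2, ← h.map_fun_eq_infinitePi_map₀' hX,
    AEMeasurable.map_map_of_aemeasurable (MeasurableEquiv.measurable _).aemeasurable
      (aemeasurable_pi_iff.2 hX)]
  rfl

section Indep

variable {Ω α β : Type*} [MeasurableSpace Ω] [MeasurableSpace α] [MeasurableSpace β]
  {μ : Measure Ω} [IsProbabilityMeasure μ] {X : Ω → α} {Y : Ω → β}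

/-- Fubini for the product law. It replaces conditioning on `X`: the value of `X` is frozen while
`Y` is run on a second copy of the sample space. -/
theorem ProbabilityTheory.IndepFun.ae_of_ae_ae (h : IndepFun X Y μ) (hX : AEMeasurable X μ)
    (hY : AEMeasurable Y μ) {C : Set (α × β)} (hC : MeasurableSet C)
    (hae : ∀ᵐ ω ∂μ, ∀ᵐ ω' ∂μ, (X ω, Y ω') ∈ C) : ∀ᵐ ω ∂μ, (X ω, Y ω) ∈ C := by
  have : IsProbabilityMeasure (μ.map Y) := Measure.isProbabilityMeasure_map hY
  refine ae_of_ae_map (f := fun ω => (X ω, Y ω)) (hX.prodMk hY) ?_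
  rw [(indepFun_iff_map_prod_eq_prod_map_map hX hY).1 h]
  have hC' : MeasurableSet {p : α × β | p ∈ C} := hC
  rw [Measure.ae_prod_iff_ae_ae hC']
  have hset : MeasurableSet {a | ∀ᵐ b ∂(μ.map Y), (a, b) ∈ C} :=
    measurable_measure_prodMk_left (ν := μ.map Y) hC.compl (measurableSet_singleton 0)
  rw [ae_map_iff hX hset]
  filter_upwards [hae] with ω hω
  exact (ae_map_iff hY (measurable_prodMk_left hC)).2 hω

theorem ProbabilityTheory.IndepFun.integral_prod_eq {E : Type*} [NormedAddCommGroup E]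
    [NormedSpace ℝ E] (h : IndepFun X Y μ) (hX : AEMeasurable X μ)
    (hY : AEMeasurable Y μ) {F : α × β → E} (hF : StronglyMeasurable F)
    (hint : Integrable (fun ω => F (X ω, Y ω)) μ) :
    ∫ ω, F (X ω, Y ω) ∂μ = ∫ ω, ∫ ω', F (X ω, Y ω') ∂μ ∂μ := by
  have : IsProbabilityMeasure (μ.map X) := Measure.isProbabilityMeasure_map hX
  have : IsProbabilityMeasure (μ.map Y) := Measure.isProbabilityMeasure_map hY
  have hlaw := (indepFun_iff_map_prod_eq_prod_map_map hX hY).1 h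
  have hi : Integrable F ((μ.map X).prod (μ.map Y)) := by
    rw [← hlaw]
    exact (integrable_map_measure hF.aestronglyMeasurable (hX.prodMk hY)).2 hint
  rw [← integral_map (f := F) (hX.prodMk hY) hF.aestronglyMeasurable, hlaw, integral_prod _ hi,
    integral_map hX hF.integral_prod_right'.aestronglyMeasurable]
  refine integral_congr_ae (ae_of_all _ fun ω => ?_)
  exact integral_map hY (hF.comp_measurable measurable_prodMk_left).aestronglyMeasurable

end Indep

/-! ### Law of one faded symbol -/

section Marks

/-- Integration against the law of an equiprobable symbol. -/
theorem integral_symbolLaw {M : ℕ} (c : Fin M → ℂ) {E : Type*} [NormedAddCommGroup E]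
    [NormedSpace ℝ E] [CompleteSpace E] {f : ℂ → E} (hf : StronglyMeasurable f) :
    ∫ z, f z ∂(symbolLaw c) = (M : ℝ)⁻¹ • ∑ m, f (c m) := by
  rw [symbolLaw, integral_map Measurable.of_discrete.aemeasurable hf.aestronglyMeasurable,
    uniformOn, ProbabilityTheory.cond, integral_smul_measure, Measure.restrict_univ,
    integral_count]
  simp

theorem isProbabilityMeasure_symbolLaw {M : ℕ} (hM : 0 < M) (c : Fin M → ℂ) :
    IsProbabilityMeasure (symbolLaw c) := by
  have : Nonempty (Fin M) := ⟨⟨0, hM⟩⟩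
  have := isProbabilityMeasure_uniformOn (Set.finite_univ (α := Fin M)) Set.univ_nonempty
  exact Measure.isProbabilityMeasure_map Measurable.of_discrete.aemeasurable

theorem symbolMoment_eq {M : ℕ} (c : Fin M → ℂ) (n : ℕ) :
    symbolMoment c n = (M : ℝ)⁻¹ * ∑ m, ‖c m‖ ^ n := by
  rw [symbolMoment, integral_symbolLaw c (by fun_prop), smul_eq_mul]

theorem memLp_symbolLaw {M : ℕ} (hM : 0 < M) (c : Fin M → ℂ) :
    MemLp id ⊤ (symbolLaw c) := by
  have := isProbabilityMeasure_symbolLaw hM c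
  refine memLp_top_of_bound (by fun_prop) (∑ m, ‖c m‖) ?_
  rw [symbolLaw]
  refine (ae_map_iff Measurable.of_discrete.aemeasurable
    (measurableSet_le (by fun_prop) (by fun_prop))).2 (ae_of_all _ fun m => ?_)
  exact Finset.single_le_sum (f := fun m => ‖c m‖) (fun _ _ => norm_nonneg _) (Finset.mem_univ m)

theorem measurable_ofReal_add_mul_I :
    Measurable (fun p : ℝ × ℝ => (p.1 : ℂ) + (p.2 : ℂ) * Complex.I) := by fun_prop

instance : IsProbabilityMeasure stdComplexGaussian :=
  Measure.isProbabilityMeasure_map measurable_ofReal_add_mul_I.aemeasurable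

theorem memLp_stdComplexGaussian : MemLp id 2 stdComplexGaussian := by
  rw [stdComplexGaussian, memLp_map_measure_iff (by fun_prop)
    measurable_ofReal_add_mul_I.aemeasurable]
  have hg : MemLp (id : ℝ → ℝ) 2 (gaussianReal 0 (1 / 2)) := memLp_id_gaussianReal 2
  have h1 : MemLp (fun p : ℝ × ℝ => (p.1 : ℂ)) 2
      ((gaussianReal 0 (1 / 2)).prod (gaussianReal 0 (1 / 2))) := (hg.comp_fst _).ofReal
  have h2 : MemLp (fun p : ℝ × ℝ => (p.2 : ℂ)) 2
      ((gaussianReal 0 (1 / 2)).prod (gaussianReal 0 (1 / 2))) := (hg.comp_snd _).ofReal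
  exact h1.add (h2.mul_const Complex.I)

theorem integral_stdComplexGaussian : ∫ z, z ∂stdComplexGaussian = 0 := by
  rw [stdComplexGaussian, integral_map measurable_ofReal_add_mul_I.aemeasurable (by fun_prop)]
  have hg : MemLp (id : ℝ → ℝ) 2 (gaussianReal 0 (1 / 2)) := memLp_id_gaussianReal 2
  have h1 : MemLp (fun p : ℝ × ℝ => (p.1 : ℂ)) 2
      ((gaussianReal 0 (1 / 2)).prod (gaussianReal 0 (1 / 2))) := (hg.comp_fst _).ofReal
  have h2 : MemLp (fun p : ℝ × ℝ => (p.2 : ℂ)) 2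
      ((gaussianReal 0 (1 / 2)).prod (gaussianReal 0 (1 / 2))) := (hg.comp_snd _).ofReal
  rw [integral_add (h1.integrable (by norm_num))
    ((h2.integrable (by norm_num)).mul_const Complex.I), integral_mul_const,
    integral_complex_ofReal, integral_complex_ofReal, integral_fun_fst (fun y : ℝ => y),
    integral_fun_snd (fun y : ℝ => y)]
  simp [integral_id_gaussianReal]

/-- Each coordinate has variance `1 / 2` and contributes `exp(-t² / 4)`; the product is radial. -/
theorem charFun_stdComplexGaussian (z : ℂ) :
    charFun stdComplexGaussian z = (Real.exp (-(‖z‖ ^ 2 / 4)) : ℝ) := by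
  rw [charFun_apply, stdComplexGaussian,
    integral_map measurable_ofReal_add_mul_I.aemeasurable (by fun_prop)]
  have h : ∀ p : ℝ × ℝ, Complex.exp ((inner ℝ ((p.1 : ℂ) + (p.2 : ℂ) * Complex.I) z : ℝ) *
      Complex.I) = Complex.exp ((z.re : ℂ) * p.1 * Complex.I) *
        Complex.exp ((z.im : ℂ) * p.2 * Complex.I) := by
    intro p
    rw [← Complex.exp_add, Complex.inner]
    congr 1
    simp
    ring
  simp only [h]
  rw [integral_prod_mul (fun u : ℝ => Complex.exp ((z.re : ℂ) * u * Complex.I))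
    (fun u : ℝ => Complex.exp ((z.im : ℂ) * u * Complex.I)),
    ← charFun_apply_real, ← charFun_apply_real, charFun_gaussianReal, charFun_gaussianReal,
    ← Complex.exp_add, Complex.ofReal_exp, Complex.sq_norm, Complex.normSq_apply]
  congr 1
  push_cast
  ring

/-- The characteristic function `r ↦ 𝔼 exp (- r ^ 2 |s| ^ 2 / 4)` of a faded symbol. -/
noncomputable def fadedCharFun {M : ℕ} (c : Fin M → ℂ) (r : ℝ) : ℝ :=
  (M : ℝ)⁻¹ * ∑ m, Real.exp (-(r ^ 2 * ‖c m‖ ^ 2 / 4))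

variable {Ω : Type*} [MeasurableSpace Ω] {μ : Measure Ω} {M : ℕ}
  {c : Fin M → ℂ} {s h : Ω → ℂ}

/-- With the symbol frozen at `v`, multiplication by `v` passes to the other side of the inner
product as its conjugate. The radial Gaussian then sees only `‖v‖ * ‖z‖`, and averaging over the
constellation remains. -/
theorem charFun_map_symbol_mul [IsProbabilityMeasure μ] (hs : HasLaw s (symbolLaw c) μ)
    (hh : HasLaw h stdComplexGaussian μ) (hsh : IndepFun s h μ) (z : ℂ) :
    charFun (μ.map fun ω => s ω * h ω) z = (fadedCharFun c ‖z‖ : ℝ) := by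
  have hsm := hs.aemeasurable
  have hhm := hh.aemeasurable
  have hF : StronglyMeasurable fun p : ℂ × ℂ =>
      Complex.exp ((inner ℝ (p.1 * p.2) z : ℝ) * Complex.I) := by
    refine Measurable.stronglyMeasurable ?_
    fun_prop
  have hshm : AEMeasurable (fun ω => s ω * h ω) μ := hsm.mul hhm
  rw [charFun_apply, integral_map hshm (by fun_prop)]
  have hint : Integrable (fun ω => Complex.exp ((inner ℝ (s ω * h ω) z : ℝ) * Complex.I)) μ := by
    refine Integrable.of_bound (C := 1) (hF.measurable.comp_aemeasurable
      (hsm.prodMk hhm)).aestronglyMeasurable (ae_of_all _ fun ω => ?_)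
    rw [Complex.norm_exp_ofReal_mul_I]
  have h1 : ∀ v : ℂ, ∫ ω', Complex.exp ((inner ℝ (v * h ω') z : ℝ) * Complex.I) ∂μ =
      (Real.exp (-(‖z‖ ^ 2 * ‖v‖ ^ 2 / 4)) : ℝ) := by
    intro v
    have h2 : ∀ u : ℂ, (inner ℝ (v * u) z : ℝ) = inner ℝ u (starRingEnd ℂ v * z) := by
      intro u
      simp only [Complex.inner, map_mul]
      congr 1
      ring
    simp only [h2]
    have h3 := hh.integral_comp (f := fun u => Complex.exp
      ((inner ℝ u (starRingEnd ℂ v * z) : ℝ) * Complex.I)) (by fun_prop)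
    rw [Function.comp_def] at h3
    rw [h3, ← charFun_apply, charFun_stdComplexGaussian, norm_mul, RCLike.norm_conj, mul_pow,
      mul_comm]
  rw [hsh.integral_prod_eq hsm hhm hF hint]
  simp only [h1]
  have h4 := hs.integral_comp (f := fun v : ℂ => ((Real.exp (-(‖z‖ ^ 2 * ‖v‖ ^ 2 / 4)) : ℝ) : ℂ))
    (by fun_prop)
  rw [Function.comp_def] at h4
  rw [h4, integral_symbolLaw c (Measurable.stronglyMeasurable (by fun_prop)), fadedCharFun]
  push_cast
  rw [Complex.real_smul]
  push_cast
  rfl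

theorem memLp_symbol_mul (hM : 0 < M) (hs : HasLaw s (symbolLaw c) μ)
    (hh : HasLaw h stdComplexGaussian μ) : MemLp (fun ω => s ω * h ω) 2 μ := by
  have h1 : MemLp s ⊤ μ := by
    have := memLp_symbolLaw hM c
    rw [← hs.map_eq] at this
    exact (memLp_map_measure_iff (by fun_prop) hs.aemeasurable).1 this
  have h2 : MemLp h 2 μ := by
    have := memLp_stdComplexGaussian
    rw [← hh.map_eq] at this
    exact (memLp_map_measure_iff (by fun_prop) hh.aemeasurable).1 this
  exact h2.mul h1

theorem integral_symbol_mul (hs : HasLaw s (symbolLaw c) μ)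
    (hh : HasLaw h stdComplexGaussian μ) (hsh : IndepFun s h μ) :
    ∫ ω, s ω * h ω ∂μ = 0 := by
  rw [hsh.integral_fun_mul_eq_mul_integral hs.aemeasurable.aestronglyMeasurable
    hh.aemeasurable.aestronglyMeasurable, hh.integral_eq, integral_stdComplexGaussian, mul_zero]

/-- Serves as a second-moment bound uniform over the interferers, so the Gaussian factor may stay
unevaluated. -/
theorem integral_norm_sq_symbol_mul (hs : HasLaw s (symbolLaw c) μ)
    (hh : HasLaw h stdComplexGaussian μ) (hsh : IndepFun s h μ) :
    ∫ ω, ‖s ω * h ω‖ ^ 2 ∂μ = symbolMoment c 2 * ∫ z, ‖z‖ ^ 2 ∂stdComplexGaussian := by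
  have hm : Measurable fun z : ℂ => ‖z‖ ^ 2 := by fun_prop
  have h1 := (hsh.comp hm hm).integral_fun_mul_eq_mul_integral
    (hm.comp_aemeasurable hs.aemeasurable).aestronglyMeasurable
    (hm.comp_aemeasurable hh.aemeasurable).aestronglyMeasurable
  simp only [norm_mul, mul_pow]
  rw [hs.integral_comp hm.aestronglyMeasurable, hh.integral_comp hm.aestronglyMeasurable] at h1
  exact h1

end Marks

/-! ### Weighted series of independent complex variables -/

/-- A series of independent centred complex random variables with bounded second moments and
square-summable real weights converges almost surely. -/
theorem ae_exists_tendsto_sum_mul {Ω : Type*} [MeasurableSpace Ω] {μ : Measure Ω}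
    [IsProbabilityMeasure μ] {W : ℕ → Ω → ℂ} (hW : ∀ k, MemLp (W k) 2 μ) (hind : iIndepFun W μ)
    (h0 : ∀ k, ∫ ω, W k ω ∂μ = 0) {C : ℝ} (hC : ∀ k, ∫ ω, ‖W k ω‖ ^ 2 ∂μ ≤ C)
    {a : ℕ → ℝ} (ha : Summable fun k => a k ^ 2) :
    ∀ᵐ ω ∂μ, ∃ l : ℂ, Tendsto (fun N => ∑ k ∈ Finset.range N, (a k : ℂ) * W k ω) atTop (𝓝 l) := by
  have key : ∀ L : ℂ →L[ℝ] ℝ, (∀ z, |L z| ≤ ‖z‖) →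
      ∀ᵐ ω ∂μ, ∃ l : ℝ, Tendsto (fun N => ∑ k ∈ Finset.range N, a k * L (W k ω)) atTop (𝓝 l) := by
    intro L hL
    have hLW : ∀ k, MemLp (fun ω => L (W k ω)) 2 μ := fun k => L.comp_memLp' (hW k)
    have hm : ∀ k, MemLp (fun ω => a k * L (W k ω)) 2 μ := fun k => (hLW k).const_mul (a k)
    refine ae_exists_tendsto_sum_of_summable_variance hm ?_ (fun k => ?_) ?_
    · exact hind.comp (fun k z => a k * L z) fun k => by fun_prop
    · rw [integral_const_mul, L.integral_comp_comm ((hW k).integrable (by norm_num)), h0 k,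
        map_zero, mul_zero]
    · refine Summable.of_nonneg_of_le (fun k => variance_nonneg _ _) (fun k => ?_)
        (ha.mul_right C)
      refine (variance_le_expectation_sq (hm k).1).trans ?_
      simp only [Pi.pow_apply, mul_pow]
      rw [integral_const_mul]
      refine mul_le_mul_of_nonneg_left ((integral_mono (hLW k).integrable_sq
        (hW k).integrable_norm_pow' fun ω => ?_).trans (hC k)) (sq_nonneg _)
      exact sq_le_sq.2 (by simpa using hL (W k ω))
  filter_upwards [key Complex.reCLM Complex.abs_re_le_norm,
    key Complex.imCLM Complex.abs_im_le_norm] with ω ⟨l₁, h₁⟩ ⟨l₂, h₂⟩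
  refine ⟨l₁ + l₂ * Complex.I, ?_⟩
  have h3 := ((Complex.continuous_ofReal.tendsto _).comp h₁).add
    (((Complex.continuous_ofReal.tendsto _).comp h₂).mul_const Complex.I)
  refine h3.congr fun N => ?_
  simp only [Function.comp_apply, Complex.reCLM_apply, Complex.imCLM_apply, Complex.ofReal_sum,
    Complex.ofReal_mul, Finset.sum_mul, ← Finset.sum_add_distrib]
  refine Finset.sum_congr rfl fun k _ => ?_
  conv_rhs => rw [← Complex.re_add_im (W k ω)]
  ring

/-- The characteristic function of a weighted sum of independent faded symbols. -/
theorem charFun_map_sum_mul {Ω : Type*} [MeasurableSpace Ω] {μ : Measure Ω}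
    [IsProbabilityMeasure μ] {W : ℕ → Ω → ℂ} (hW : ∀ k, AEMeasurable (W k) μ)
    (hind : iIndepFun W μ) (a : ℕ → ℝ) (N : ℕ) (z : ℂ) :
    charFun (μ.map fun ω => ∑ k ∈ Finset.range N, (a k : ℂ) * W k ω) z =
      ∏ k ∈ Finset.range N, charFun (μ.map (W k)) (a k * z) := by
  have hi : iIndepFun (fun k ω => (a k : ℂ) * W k ω) μ :=
    hind.comp (fun k z => (a k : ℂ) * z) fun k => by fun_prop
  rw [(hi.precomp Subtype.val_injective).charFun_map_fun_finsetSum_eq_prod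
    fun k _ => (hW k).const_mul _, Finset.prod_apply]
  refine Finset.prod_congr rfl fun k _ => ?_
  have h1 := charFun_map_smul_comp (hW k) (a k) z
  simpa only [Complex.real_smul] using h1

/-! ### Radial integration against the intensity measure -/

section Exterior

variable {lam η r₀ : ℝ}

theorem exteriorIntensity_ball_ne_top (lam r₀ R : ℝ) :
    exteriorIntensity lam r₀ (Metric.ball 0 R) ≠ ⊤ := by
  rw [exteriorIntensity, Measure.smul_apply, smul_eq_mul]
  exact ENNReal.mul_ne_top ENNReal.ofReal_ne_top
    (((Measure.restrict_apply_le _ _).trans_lt measure_ball_lt_top).ne)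

theorem measurableSet_exterior (r₀ : ℝ) : MeasurableSet {y : Plane | r₀ < ‖y‖} :=
  measurableSet_lt measurable_const measurable_norm

theorem indicator_exterior_norm (g : ℝ → ℝ) (r₀ : ℝ) :
    {y : Plane | r₀ < ‖y‖}.indicator (fun y => g ‖y‖) =
      fun y : Plane => (Set.Ioi r₀).indicator g ‖y‖ := by
  funext y
  simp [Set.indicator]

theorem integrable_exteriorIntensity {g : ℝ → ℝ}
    (hg : IntegrableOn (fun r => r * g r) (Set.Ioi r₀)) :
    Integrable (fun y : Plane => g ‖y‖) (exteriorIntensity lam r₀) := by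
  refine Integrable.smul_measure ?_ ENNReal.ofReal_ne_top
  rw [← IntegrableOn, ← integrable_indicator_iff (measurableSet_exterior r₀),
    indicator_exterior_norm, integrable_fun_norm_addHaar]
  have h1 : ∀ y : ℝ, y ^ (Module.finrank ℝ Plane - 1) • (Set.Ioi r₀).indicator g y =
      (Set.Ioi r₀).indicator (fun r => r * g r) y := by
    intro y
    simp [Set.indicator]
  simp only [h1]
  exact ((integrable_indicator_iff measurableSet_Ioi).2 hg).integrableOn

/-- Polar coordinates; `2 * π` arises as the dimension times the area of the unit disc. -/
theorem integral_exteriorIntensity (g : ℝ → ℝ) (hlam : 0 ≤ lam) (hr₀ : 0 < r₀) :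
    ∫ y : Plane, g ‖y‖ ∂(exteriorIntensity lam r₀) =
      2 * Real.pi * lam * ∫ r in Set.Ioi r₀, r * g r := by
  have h1 : ∀ y : ℝ, y ^ (Module.finrank ℝ Plane - 1) • (Set.Ioi r₀).indicator g y =
      (Set.Ioi r₀).indicator (fun r => r * g r) y := by
    intro y
    simp [Set.indicator]
  rw [exteriorIntensity, integral_smul_measure, ← integral_indicator (measurableSet_exterior r₀),
    indicator_exterior_norm, integral_fun_norm_addHaar]
  simp only [h1]
  rw [setIntegral_indicator measurableSet_Ioi, Set.inter_eq_self_of_subset_right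
    (Set.Ioi_subset_Ioi hr₀.le)]
  simp only [Measure.real, EuclideanSpace.volume_ball_fin_two, ENNReal.toReal_ofReal hlam]
  simp [Real.pi_nonneg]
  ring

theorem integrableOn_mul_rpow_neg (hη : 2 < η) (hr₀ : 0 < r₀) :
    IntegrableOn (fun r : ℝ => r * r ^ (-η)) (Set.Ioi r₀) := by
  have h := integrableOn_Ioi_rpow_of_lt (a := 1 - η) (by linarith) hr₀
  refine h.congr_fun (fun r hr => ?_) measurableSet_Ioi
  have hr' : 0 < r := hr₀.trans hr
  simp only
  rw [sub_eq_add_neg, Real.rpow_add hr', Real.rpow_one]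

end Exterior

/-! ### Kummer's function and the radial integral -/

section Kummer

variable {η : ℝ}

/-- Both sides are `a (a + 1) ⋯ (a + n)`, with the last or the first factor split off. -/
theorem eval_ascPochhammer_mul_add (a : ℝ) (n : ℕ) :
    (ascPochhammer ℝ n).eval a * (a + n) = a * (ascPochhammer ℝ n).eval (a + 1) := by
  induction n with
  | zero => simp
  | succ n ih =>
    rw [ascPochhammer_succ_eval, ascPochhammer_succ_eval, ih]
    push_cast
    ring

/-- The two parameters differ by `1`, so the quotient telescopes to `a / (a + n)` with `a = -2 / η`.
-/
theorem eval_ascPochhammer_div (hη : 2 < η) (n : ℕ) :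
    (ascPochhammer ℝ n).eval (-(2 / η)) / (ascPochhammer ℝ n).eval (1 - 2 / η) =
      -2 / (η * n - 2) := by
  have hη0 : 0 < η := by linarith
  have h := eval_ascPochhammer_mul_add (-(2 / η)) n
  rw [neg_add_eq_sub _ (1 : ℝ)] at h
  have hb : 0 < 1 - 2 / η := by rw [sub_pos, div_lt_one hη0]; exact hη
  have hpos : (ascPochhammer ℝ n).eval (1 - 2 / η) ≠ 0 := (ascPochhammer_pos n _ hb).ne'
  have hden : η * n - 2 ≠ 0 := by
    rcases n.eq_zero_or_pos with rfl | hn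
    · norm_num
    · have : (1 : ℝ) ≤ n := Nat.one_le_cast.2 hn
      nlinarith
  rw [div_eq_div_iff hpos hden]
  have h2 : η * (-(2 / η) + (n : ℝ)) = η * n - 2 := by field_simp; ring
  rw [← h2]
  calc _ = η * ((ascPochhammer ℝ n).eval (-(2 / η)) * (-(2 / η) + n)) := by ring
    _ = _ := by rw [h]; field_simp

theorem summable_kummer_term (hη : 2 < η) (z : ℝ) :
    Summable fun n : ℕ => z ^ (n + 1) / ((η * (n + 1 : ℕ) - 2) * ((n + 1)! : ℝ)) := by
  have h1 : Summable fun n : ℕ => (η - 2)⁻¹ * (|z| ^ (n + 1) / ((n + 1)! : ℝ)) :=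
    ((summable_nat_add_iff 1).2 (Real.summable_pow_div_factorial |z|)).mul_left _
  refine h1.of_norm_bounded fun n => ?_
  have hd : η - 2 ≤ η * (n + 1 : ℕ) - 2 := by
    push_cast
    have : (0 : ℝ) ≤ n := n.cast_nonneg
    nlinarith
  have hd0 : 0 < η - 2 := by linarith
  have hd1 : 0 < η * (n + 1 : ℕ) - 2 := hd0.trans_le hd
  rw [norm_div, norm_mul, norm_pow, Real.norm_eq_abs, Real.norm_of_nonneg hd1.le,
    Real.norm_of_nonneg (by positivity), ← div_div, div_right_comm, div_eq_mul_inv _ (_ - _),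
    mul_comm]
  gcongr

/-- The Kummer function of the interference problem as a power series. -/
theorem hasSum_kummer (hη : 2 < η) (z : ℝ) :
    HasSum (fun n : ℕ => z ^ (n + 1) / ((η * (n + 1 : ℕ) - 2) * ((n + 1)! : ℝ)))
      ((1 - kummer (-(2 / η)) (1 - 2 / η) z) / 2) := by
  have h := (summable_kummer_term hη z).hasSum
  convert h using 1
  have hk : kummer (-(2 / η)) (1 - 2 / η) z =
      ∑' n : ℕ, -2 * (z ^ n / ((η * n - 2) * (n ! : ℝ))) := by
    refine tsum_congr fun n => ?_
    rw [eval_ascPochhammer_div hη, div_mul_eq_div_div]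
    ring
  have hs : Summable fun n : ℕ => z ^ n / ((η * n - 2) * (n ! : ℝ)) :=
    (summable_nat_add_iff 1).1 (summable_kummer_term hη z)
  -- The zeroth term of Kummer's series is `1`; the remaining terms are `-2` times the claimed
  -- series.
  rw [hk, tsum_mul_left, hs.tsum_eq_zero_add]
  norm_num
  ring

theorem hasSum_kummer_pnat (hη : 2 < η) (z : ℝ) :
    HasSum (fun k : ℕ+ => z ^ (k : ℕ) / ((η * ((k : ℕ) : ℝ) - 2) * ((k : ℕ)! : ℝ)))
      ((1 - kummer (-(2 / η)) (1 - 2 / η) z) / 2) := by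
  refine (Equiv.pnatEquivNat.symm.hasSum_iff (f := fun k : ℕ+ =>
    z ^ (k : ℕ) / ((η * ((k : ℕ) : ℝ) - 2) * ((k : ℕ)! : ℝ)))).1 ?_
  exact hasSum_kummer hη z

theorem abs_one_sub_exp_neg_le {u : ℝ} (hu : 0 ≤ u) : |1 - Real.exp (-u)| ≤ u := by
  rw [abs_of_nonneg (sub_nonneg.2 (Real.exp_le_one_iff.2 (neg_nonpos.2 hu)))]
  linarith [Real.add_one_le_exp (-u)]

theorem integrableOn_mul_one_sub_exp {r₀ A : ℝ} (hη : 2 < η) (hr₀ : 0 < r₀) (hA : 0 ≤ A) :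
    IntegrableOn (fun r : ℝ => r * (1 - Real.exp (-(A * r ^ (-η))))) (Set.Ioi r₀) := by
  refine ((integrableOn_mul_rpow_neg hη hr₀).const_mul A).mono'
    (Measurable.aestronglyMeasurable (by fun_prop)) ?_
  filter_upwards [ae_restrict_mem measurableSet_Ioi] with r hr
  have hr' : 0 < r := hr₀.trans hr
  rw [norm_mul, Real.norm_of_nonneg hr'.le, Real.norm_eq_abs]
  have := abs_one_sub_exp_neg_le (mul_nonneg hA (Real.rpow_nonneg hr'.le (-η)))
  calc _ ≤ r * (A * r ^ (-η)) := by gcongr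
    _ = _ := by ring

/-- The radial integral of the interference problem in terms of the Kummer function. -/
theorem integral_mul_one_sub_exp {r₀ A : ℝ} (hη : 2 < η) (hr₀ : 0 < r₀) (hA : 0 ≤ A) :
    ∫ r in Set.Ioi r₀, r * (1 - Real.exp (-(A * r ^ (-η)))) =
      -(r₀ ^ 2 / 2 * (1 - kummer (-(2 / η)) (1 - 2 / η) (-(A / r₀ ^ η)))) := by
  -- The terms of `r * (1 - exp(-A * r ^ (-η)))`. The `1` cancels the constant term of the
  -- exponential, so powers start at `n + 1` and each term is integrable at infinity.
  set F : ℕ → ℝ → ℝ := fun n r =>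
    -((-A) ^ (n + 1) / ((n + 1)! : ℝ)) * r ^ (1 - η * (n + 1 : ℕ)) with hF
  have hexp : ∀ n : ℕ, 1 - η * (n + 1 : ℕ) < -1 := by
    intro n
    push_cast
    have : (0 : ℝ) ≤ n := n.cast_nonneg
    nlinarith
  have hpow : ∀ (n : ℕ), r₀ ^ (1 - η * (n + 1 : ℕ) + 1) = r₀ ^ 2 * (1 / r₀ ^ η) ^ (n + 1) := by
    intro n
    rw [show 1 - η * ((n + 1 : ℕ) : ℝ) + 1 = ((2 : ℕ) : ℝ) - η * ((n + 1 : ℕ) : ℝ) by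
      push_cast; ring, Real.rpow_sub hr₀, Real.rpow_mul hr₀.le, Real.rpow_natCast,
      Real.rpow_natCast, one_div, inv_pow, div_eq_mul_inv]
  have hval : ∀ (b : ℝ) (n : ℕ), ∫ r in Set.Ioi r₀, b * r ^ (1 - η * (n + 1 : ℕ)) =
      b * (r₀ ^ 2 * (1 / r₀ ^ η) ^ (n + 1) / (η * (n + 1 : ℕ) - 2)) := by
    intro b n
    rw [integral_const_mul, integral_Ioi_rpow_of_lt (hexp n) hr₀, hpow, neg_div, ← div_neg]
    congr 3
    ring
  have hint : ∀ n, Integrable (F n) (volume.restrict (Set.Ioi r₀)) := fun n =>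
    (integrableOn_Ioi_rpow_of_lt (hexp n) hr₀).const_mul _
  have hnorm : ∀ n, ∫ r in Set.Ioi r₀, ‖F n r‖ =
      r₀ ^ 2 * ((A / r₀ ^ η) ^ (n + 1) / ((η * (n + 1 : ℕ) - 2) * ((n + 1)! : ℝ))) := by
    intro n
    have h1 : ∫ r in Set.Ioi r₀, ‖F n r‖ =
        ∫ r in Set.Ioi r₀, (A ^ (n + 1) / ((n + 1)! : ℝ)) * r ^ (1 - η * (n + 1 : ℕ)) := by
      refine setIntegral_congr_fun measurableSet_Ioi fun r hr => ?_
      have hr' : 0 < r := hr₀.trans hr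
      simp only [hF]
      rw [norm_mul, norm_neg, norm_div, norm_pow, norm_neg, Real.norm_of_nonneg hA,
        Real.norm_of_nonneg (by positivity), Real.norm_of_nonneg (by positivity)]
    rw [h1, hval, div_pow, div_pow, one_pow, div_mul_eq_div_div]
    ring
  -- The integrals of the norms form a multiple of the same convergent series at `+A / r₀ ^ η`,
  -- which justifies integrating termwise.
  have hsum := hasSum_integral_of_summable_integral_norm hint (by
    simp only [hnorm]
    exact (summable_kummer_term hη _).mul_left _)
  have htsum : ∀ r ∈ Set.Ioi r₀, ∑' n, F n r = r * (1 - Real.exp (-(A * r ^ (-η)))) := by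
    intro r hr
    have hr' : 0 < r := hr₀.trans hr
    have h1 := (hasSum_nat_add_iff' 1).2
      (NormedSpace.expSeries_div_hasSum_exp (-(A * r ^ (-η))))
    rw [← Real.exp_eq_exp_ℝ] at h1
    have h2 := h1.mul_left (-r)
    simp only [Finset.range_one, Finset.sum_singleton, pow_zero, Nat.factorial_zero,
      Nat.cast_one, div_one] at h2
    rw [show r * (1 - Real.exp (-(A * r ^ (-η)))) = -r * (Real.exp (-(A * r ^ (-η))) - 1) by ring,
      ← h2.tsum_eq]
    refine tsum_congr fun n => ?_
    simp only [hF]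
    rw [sub_eq_add_neg, Real.rpow_add hr', Real.rpow_one, ← neg_mul, Real.rpow_mul hr'.le,
      Real.rpow_natCast, ← neg_mul, mul_pow]
    ring
  rw [setIntegral_congr_fun measurableSet_Ioi htsum] at hsum
  refine hsum.unique ?_
  have h3 := (hasSum_kummer hη (-(A / r₀ ^ η))).mul_left (-(r₀ ^ 2))
  have h4 : (fun n => ∫ r in Set.Ioi r₀, F n r) = fun n : ℕ => -(r₀ ^ 2) *
      ((-(A / r₀ ^ η)) ^ (n + 1) / ((η * (n + 1 : ℕ) - 2) * ((n + 1)! : ℝ))) := by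
    funext n
    simp only [hF]
    rw [hval, ← neg_div (r₀ ^ η) A, div_pow, div_pow, one_pow, div_mul_eq_div_div]
    ring
  rw [h4, show -(r₀ ^ 2 / 2 * (1 - kummer (-(2 / η)) (1 - 2 / η) (-(A / r₀ ^ η)))) =
    -(r₀ ^ 2) * ((1 - kummer (-(2 / η)) (1 - 2 / η) (-(A / r₀ ^ η))) / 2) by ring]
  exact h3

end Kummer

/-! ### Everywhere convergent power series on the real line -/

section PowerSeries

variable {b : ℕ → ℂ} {f : ℝ → ℂ}

/-- The formal power series with coefficients `b`. -/
noncomputable def coeffSeries (b : ℕ → ℂ) : FormalMultilinearSeries ℝ ℝ ℂ :=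
  fun n => ContinuousMultilinearMap.mkPiRing ℝ (Fin n) (b n)

/-- Summability at every real `t` forces an infinite radius of convergence. -/
theorem hasFPowerSeriesOnBall_of_hasSum (h : ∀ t : ℝ, HasSum (fun n => (t : ℂ) ^ n * b n) (f t)) :
    HasFPowerSeriesOnBall f (coeffSeries b) 0 ⊤ where
  r_le := by
    rw [FormalMultilinearSeries.radius_eq_top_of_summable_norm]
    intro r
    have := (h r).summable.norm
    simpa [coeffSeries, mul_comm] using this
  r_pos := by simp
  hasSum := by
    intro y _
    simpa [coeffSeries] using h y

theorem contDiff_of_hasSum (h : ∀ t : ℝ, HasSum (fun n => (t : ℂ) ^ n * b n) (f t))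
    (n : WithTop ℕ∞) : ContDiff ℝ n f := by
  have h1 : AnalyticOnNhd ℝ f (Metric.eball 0 ⊤) :=
    (hasFPowerSeriesOnBall_of_hasSum h).analyticOnNhd
  rw [contDiff_iff_contDiffAt]
  exact fun t => (h1 t (by simp)).contDiffAt

theorem iteratedDeriv_zero_of_hasSum
    (h : ∀ t : ℝ, HasSum (fun n => (t : ℂ) ^ n * b n) (f t)) (n : ℕ) :
    iteratedDeriv n f 0 = (n ! : ℂ) * b n := by
  have h1 := (hasFPowerSeriesOnBall_of_hasSum h).factorial_smul (1 : ℝ) n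
  rw [iteratedDeriv, ← h1]
  simp [coeffSeries]

end PowerSeries

/-! ### Second moments from the characteristic function -/

section SecondMoment

variable {Ω : Type*} [MeasurableSpace Ω] {μ : Measure Ω} [IsProbabilityMeasure μ] {X : Ω → ℝ}

theorem integrable_cos_mul (hX : AEMeasurable X μ) (t : ℝ) :
    Integrable (fun ω => Real.cos (t * X ω)) μ := by
  refine Integrable.of_bound (C := 1)
    (Real.measurable_cos.comp_aemeasurable (hX.const_mul t)).aestronglyMeasurable
    (ae_of_all _ fun ω => ?_)
  exact Real.abs_cos_le_one _

theorem re_charFun_map_eq_integral_cos (hX : AEMeasurable X μ) (t : ℝ) :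
    (charFun (μ.map X) t).re = ∫ ω, Real.cos (t * X ω) ∂μ := by
  rw [charFun_apply_real, integral_map hX (by fun_prop)]
  have hi : Integrable (fun ω => Complex.exp (t * X ω * Complex.I)) μ := by
    refine Integrable.of_bound (C := 1) ?_ (ae_of_all _ fun ω => ?_)
    · exact (Measurable.comp_aemeasurable (g := fun u : ℝ => Complex.exp (t * u * Complex.I))
        (by fun_prop) hX).aestronglyMeasurable
    · rw [← Complex.ofReal_mul, Complex.norm_exp_ofReal_mul_I]
  have h := integral_re (𝕜 := ℂ) hi
  simp only [RCLike.re_eq_complex_re] at h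
  rw [← h]
  refine integral_congr_ae (ae_of_all _ fun ω => ?_)
  simp only
  rw [← Complex.ofReal_mul, Complex.exp_ofReal_mul_I_re]

/-- A random variable whose characteristic function is `1 - O(t ^ 2)` is square-integrable. -/
theorem memLp_two_of_charFun_le (hX : AEMeasurable X μ) {C : ℝ}
    (h : ∀ t : ℝ, 1 - (charFun (μ.map X) t).re ≤ C * t ^ 2) : MemLp X 2 μ := by
  -- The factor `π² / 2` inverts `1 - cos u ≥ 2 u² / π²`, valid for `|u| ≤ π`. With `u = X / (n +
  -- 1)`, `g n` eventually dominates `X²`, while its integral is bounded by `π² / 2 * C`; Fatou's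
  -- lemma concludes.
  set g : ℕ → Ω → ℝ := fun n ω =>
    Real.pi ^ 2 / 2 * ((n : ℝ) + 1) ^ 2 * (1 - Real.cos (((n : ℝ) + 1)⁻¹ * X ω)) with hg
  have hg0 : ∀ n ω, 0 ≤ g n ω := fun n ω =>
    mul_nonneg (by positivity) (sub_nonneg.2 (Real.cos_le_one _))
  have hgi : ∀ n, Integrable (g n) μ := fun n =>
    ((integrable_const 1).sub (integrable_cos_mul hX _)).const_mul _
  have hgint : ∀ n, ∫⁻ ω, ENNReal.ofReal (g n ω) ∂μ ≤ ENNReal.ofReal (Real.pi ^ 2 / 2 * C) := by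
    intro n
    rw [← ofReal_integral_eq_lintegral_ofReal (hgi n) (ae_of_all _ (hg0 n))]
    refine ENNReal.ofReal_le_ofReal ?_
    simp only [hg]
    rw [integral_const_mul, integral_sub (integrable_const 1) (integrable_cos_mul hX _),
      ← re_charFun_map_eq_integral_cos hX]
    simp only [integral_const, probReal_univ, one_smul]
    calc _ ≤ Real.pi ^ 2 / 2 * ((n : ℝ) + 1) ^ 2 * (C * (((n : ℝ) + 1)⁻¹) ^ 2) := by
          gcongr
          exact h _
      _ = _ := by field_simp
  have hlim : ∀ ω, ENNReal.ofReal (X ω ^ 2) ≤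
      liminf (fun n => ENNReal.ofReal (g n ω)) atTop := by
    intro ω
    refine le_liminf_of_le (by isBoundedDefault) ?_
    obtain ⟨N, hN⟩ := exists_nat_ge |X ω|
    filter_upwards [eventually_ge_atTop N] with n hn
    refine ENNReal.ofReal_le_ofReal ?_
    have hn0 : (0 : ℝ) < (n : ℝ) + 1 := by positivity
    have hle : |X ω| ≤ (n : ℝ) + 1 := hN.trans ((Nat.cast_le.2 hn).trans (by linarith))
    have habs : |((n : ℝ) + 1)⁻¹ * X ω| ≤ Real.pi := by
      rw [abs_mul, abs_of_pos (inv_pos.2 hn0), inv_mul_le_iff₀ hn0]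
      nlinarith [Real.pi_gt_three]
    have hcos := Real.cos_le_one_sub_mul_cos_sq habs
    simp only [hg]
    calc X ω ^ 2 = Real.pi ^ 2 / 2 * ((n : ℝ) + 1) ^ 2 *
          (2 / Real.pi ^ 2 * (((n : ℝ) + 1)⁻¹ * X ω) ^ 2) := by
          field_simp [Real.pi_ne_zero]
      _ ≤ _ := by gcongr; linarith
  refine (memLp_two_iff_integrable_sq hX.aestronglyMeasurable).2
    ⟨(hX.pow_const 2).aestronglyMeasurable, ?_⟩
  rw [hasFiniteIntegral_iff_ofReal (ae_of_all _ fun ω => sq_nonneg _)]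
  calc ∫⁻ ω, ENNReal.ofReal (X ω ^ 2) ∂μ
      ≤ ∫⁻ ω, liminf (fun n => ENNReal.ofReal (g n ω)) atTop ∂μ := lintegral_mono hlim
    _ ≤ liminf (fun n => ∫⁻ ω, ENNReal.ofReal (g n ω) ∂μ) atTop :=
        lintegral_liminf_le' fun n => (hgi n).1.aemeasurable.ennreal_ofReal
    _ ≤ ENNReal.ofReal (Real.pi ^ 2 / 2 * C) := by
        refine liminf_le_of_le (by isBoundedDefault) fun a ha => ?_
        obtain ⟨n, hn⟩ := ha.exists
        exact hn.trans (hgint n)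
    _ < ⊤ := ENNReal.ofReal_lt_top

/-- The second moment of a centred random variable from the logarithm of its characteristic
function. -/
theorem integral_sq_eq_neg_iteratedDeriv (hmem : MemLp X 2 μ) {l : ℝ → ℂ}
    (hl : ContDiff ℝ 2 l) (hφ : ∀ t, charFun (μ.map X) t = Complex.exp (l t)) (h0 : l 0 = 0)
    (h1 : deriv l 0 = 0) : ((∫ ω, X ω ^ 2 ∂μ : ℝ) : ℂ) = -iteratedDeriv 2 l 0 := by
  have hXm := hmem.1.aemeasurable
  have : IsProbabilityMeasure (μ.map X) := Measure.isProbabilityMeasure_map hXm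
  have hid : MemLp id (2 : ℕ) (μ.map X) :=
    (memLp_map_measure_iff (by fun_prop) hXm).2 (by simpa using hmem)
  have h2 := iteratedDeriv_charFun_zero hid
  rw [integral_map hXm (by fun_prop), funext hφ, Complex.I_sq, neg_one_mul] at h2
  rw [eq_neg_iff_add_eq_zero, add_comm, ← eq_neg_iff_add_eq_zero, ← h2]
  have hd : ∀ t, HasDerivAt l (deriv l t) t := fun t =>
    (hl.differentiable (by norm_num) t).hasDerivAt
  have hd2 : HasDerivAt (deriv l) (deriv (deriv l) 0) 0 :=
    ((hl.iterate_deriv' 1 1).differentiable (by norm_num) 0).hasDerivAt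
  -- The second derivative of `exp ∘ l` is `exp l * (l'² + l'')`, which is `l''` at `0` since `l`
  -- and `l'` vanish there.
  have h3 : deriv (fun t => Complex.exp (l t)) = fun t => Complex.exp (l t) * deriv l t :=
    funext fun t => (hd t).cexp.deriv
  rw [iteratedDeriv_succ, iteratedDeriv_one, iteratedDeriv_succ, iteratedDeriv_one, h3,
    ((hd 0).cexp.fun_mul hd2).deriv, h1, h0]
  simp

end SecondMoment

/-! ### Bounds for the characteristic function of a faded symbol -/

section Faded

variable {M : ℕ} {c : Fin M → ℂ}

theorem pos_of_symbolMoment_two_eq_one (hc : symbolMoment c 2 = 1) : 0 < M := by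
  rcases M.eq_zero_or_pos with rfl | h
  · simp [symbolMoment_eq] at hc
  · exact h

theorem fadedCharFun_le_one (r : ℝ) : fadedCharFun c r ≤ 1 := by
  rcases M.eq_zero_or_pos with rfl | hM
  · simp [fadedCharFun]
  have hM' : (0 : ℝ) < M := Nat.cast_pos.2 hM
  rw [fadedCharFun, inv_mul_le_iff₀ hM', mul_one]
  calc ∑ m, Real.exp (-(r ^ 2 * ‖c m‖ ^ 2 / 4)) ≤ ∑ _m : Fin M, (1 : ℝ) :=
        Finset.sum_le_sum fun m _ => Real.exp_le_one_iff.2 (neg_nonpos.2 (by positivity))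
    _ = M := by simp

/-- Jensen's inequality for the characteristic function of a faded symbol of unit power. -/
theorem exp_le_fadedCharFun (hc : symbolMoment c 2 = 1) (r : ℝ) :
    Real.exp (-(r ^ 2 / 4)) ≤ fadedCharFun c r := by
  have hM : (0 : ℝ) < M := Nat.cast_pos.2 (pos_of_symbolMoment_two_eq_one hc)
  have h := convexOn_exp.map_sum_le (t := Finset.univ) (w := fun _ : Fin M => (M : ℝ)⁻¹)
    (p := fun m => -(r ^ 2 * ‖c m‖ ^ 2 / 4)) (fun _ _ => by positivity)
    (by simp [hM.ne']) (fun _ _ => Set.mem_univ _)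
  rw [symbolMoment_eq] at hc
  simp only [smul_eq_mul, ← Finset.mul_sum] at h
  refine le_trans (le_of_eq ?_) h
  congr 1
  rw [Finset.sum_neg_distrib, ← Finset.sum_div, ← Finset.mul_sum]
  calc -(r ^ 2 / 4) = -(r ^ 2 / 4) * ((M : ℝ)⁻¹ * ∑ m, ‖c m‖ ^ 2) := by rw [hc, mul_one]
    _ = _ := by ring

theorem fadedCharFun_pos (hc : symbolMoment c 2 = 1) (r : ℝ) : 0 < fadedCharFun c r :=
  (Real.exp_pos _).trans_le (exp_le_fadedCharFun hc r)

theorem neg_log_fadedCharFun_nonneg (hc : symbolMoment c 2 = 1) (r : ℝ) :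
    0 ≤ -Real.log (fadedCharFun c r) :=
  neg_nonneg.2 (Real.log_nonpos (fadedCharFun_pos hc r).le (fadedCharFun_le_one r))

/-- Jensen's bound in logarithmic form; being quadratic, it lets the received power dominate the
exponent of the Laplace functional. -/
theorem neg_log_fadedCharFun_le (hc : symbolMoment c 2 = 1) (r : ℝ) :
    -Real.log (fadedCharFun c r) ≤ r ^ 2 / 4 := by
  rw [neg_le]
  exact (Real.le_log_iff_exp_le (fadedCharFun_pos hc r)).2 (exp_le_fadedCharFun hc r)

theorem measurable_fadedCharFun : Measurable (fadedCharFun c) := by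
  unfold fadedCharFun
  fun_prop

end Faded

/-! ### The exponent of the characteristic function and its Taylor series -/

/-- The amplitude `√P * ‖y‖ ^ (-η / 2)` received from a transmitter at `y`. -/
noncomputable def pathGain (P η : ℝ) (y : Plane) : ℝ := √P * ‖y‖ ^ (-(η / 2))

/-- The exponent of the characteristic function of the aggregate interference. -/
noncomputable def interferenceExponent (lam P η r₀ : ℝ) {M : ℕ} (c : Fin M → ℂ) (t : ℝ) : ℝ :=
  Real.pi * lam / M * ∑ m : Fin M, r₀ ^ 2 * (1 - kummer (-(2 / η)) (1 - 2 / η)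
    (-(t ^ 2 * P * ‖c m‖ ^ 2 / (4 * r₀ ^ η))))

section Exponent

variable {lam P η r₀ : ℝ} {M : ℕ} {c : Fin M → ℂ}

theorem measurable_pathGain (P η : ℝ) : Measurable (pathGain P η) := by
  unfold pathGain
  fun_prop

theorem pathGain_sq (hP : 0 ≤ P) (η : ℝ) (y : Plane) :
    pathGain P η y ^ 2 = P * ‖y‖ ^ (-η) := by
  rw [pathGain, mul_pow, Real.sq_sqrt hP, ← Real.rpow_mul_natCast (norm_nonneg _)]
  congr 2
  push_cast
  ring

theorem integrable_pathGain_sq (hP : 0 ≤ P) (hη : 2 < η) (hr₀ : 0 < r₀) :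
    Integrable (fun y => pathGain P η y ^ 2) (exteriorIntensity lam r₀) := by
  simp only [pathGain_sq hP]
  exact (integrable_exteriorIntensity (g := fun r => r ^ (-η))
    (integrableOn_mul_rpow_neg hη hr₀)).const_mul P

/-- The intensity integral of the interference in terms of Kummer's function. -/
theorem integral_one_sub_fadedCharFun (hlam : 0 < lam) (hP : 0 < P) (hη : 2 < η) (hr₀ : 0 < r₀)
    (hM : 0 < M) {t : ℝ} :
    ∫ y, (1 - fadedCharFun c (pathGain P η y * t)) ∂(exteriorIntensity lam r₀) =
      -interferenceExponent lam P η r₀ c t := by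
  have hM' : (M : ℝ) ≠ 0 := (Nat.cast_pos.2 hM).ne'
  set A : Fin M → ℝ := fun m => t ^ 2 * P * ‖c m‖ ^ 2 / 4 with hA
  have hA0 : ∀ m, 0 ≤ A m := fun m => by positivity
  have h1 : ∀ y : Plane, 1 - fadedCharFun c (pathGain P η y * t) =
      (fun r : ℝ => (M : ℝ)⁻¹ * ∑ m, (1 - Real.exp (-(A m * r ^ (-η))))) ‖y‖ := by
    intro y
    simp only [fadedCharFun, Finset.sum_sub_distrib, mul_sub]
    simp only [Finset.sum_const, Finset.card_univ, Fintype.card_fin, nsmul_eq_mul, mul_one]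
    rw [inv_mul_cancel₀ hM']
    congr 3
    funext m
    rw [mul_pow, pathGain_sq hP.le]
    simp only [hA]
    ring_nf
  simp only [h1]
  rw [integral_exteriorIntensity (fun r : ℝ => (M : ℝ)⁻¹ * ∑ m,
    (1 - Real.exp (-(A m * r ^ (-η))))) hlam.le hr₀]
  have h2 : ∀ r : ℝ, r * ((M : ℝ)⁻¹ * ∑ m, (1 - Real.exp (-(A m * r ^ (-η))))) =
      (M : ℝ)⁻¹ * ∑ m, r * (1 - Real.exp (-(A m * r ^ (-η)))) := by
    intro r
    rw [← Finset.mul_sum]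
    ring
  simp only [h2]
  rw [integral_const_mul, integral_finsetSum _ fun m _ =>
    integrableOn_mul_one_sub_exp hη hr₀ (hA0 m)]
  simp only [integral_mul_one_sub_exp hη hr₀ (hA0 _)]
  rw [interferenceExponent, Finset.sum_neg_distrib]
  simp only [div_mul_eq_mul_div, ← Finset.sum_div, hA, div_div]
  ring

/-- Integrates `1 - ψ(r) ≤ 1 - exp(-r² / 4) ≤ r² / 4`. The resulting `O(t²)` is what makes the
interference power finite. -/
theorem neg_interferenceExponent_le (hlam : 0 < lam) (hP : 0 < P) (hη : 2 < η) (hr₀ : 0 < r₀)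
    (hc : symbolMoment c 2 = 1) (t : ℝ) :
    -interferenceExponent lam P η r₀ c t ≤
      (∫ y, pathGain P η y ^ 2 / 4 ∂(exteriorIntensity lam r₀)) * t ^ 2 := by
  rw [← integral_one_sub_fadedCharFun hlam hP hη hr₀ (pos_of_symbolMoment_two_eq_one hc),
    ← integral_mul_const]
  refine integral_mono_of_nonneg (ae_of_all _ fun y => sub_nonneg.2 (fadedCharFun_le_one _))
    (((integrable_pathGain_sq hP.le hη hr₀).div_const 4).mul_const _) (ae_of_all _ fun y => ?_)
  have h1 := exp_le_fadedCharFun hc (pathGain P η y * t)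
  have h2 := Real.add_one_le_exp (-((pathGain P η y * t) ^ 2 / 4))
  simp only
  nlinarith

theorem interferenceExponent_eq (lam P η r₀ : ℝ) (c : Fin M → ℂ) (t : ℝ) :
    interferenceExponent lam P η r₀ c t = 2 * Real.pi * lam * r₀ ^ 2 *
      ((M : ℝ)⁻¹ * ∑ m, (1 - kummer (-(2 / η)) (1 - 2 / η)
        (-(t ^ 2 * P * ‖c m‖ ^ 2 / (4 * r₀ ^ η)))) / 2) := by
  rw [interferenceExponent, ← Finset.mul_sum, ← Finset.sum_div]
  ring

/-- The power series of the exponent of the characteristic function. -/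
theorem hasSum_interferenceExponent_pnat (hη : 2 < η) (t : ℝ) :
    HasSum (fun k : ℕ+ => (-1 : ℝ) ^ (k : ℕ) * t ^ (2 * (k : ℕ)) *
        symbolMoment c (2 * (k : ℕ)) / ((η * ((k : ℕ) : ℝ) - 2) * ((k : ℕ)! : ℝ)) *
          (P / (4 * r₀ ^ η)) ^ (k : ℕ))
      ((M : ℝ)⁻¹ * ∑ m, (1 - kummer (-(2 / η)) (1 - 2 / η)
        (-(t ^ 2 * P * ‖c m‖ ^ 2 / (4 * r₀ ^ η)))) / 2) := by
  have h := (hasSum_sum fun m (_ : m ∈ Finset.univ) =>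
    hasSum_kummer_pnat hη (-(t ^ 2 * P * ‖c m‖ ^ 2 / (4 * r₀ ^ η)))).mul_left (M : ℝ)⁻¹
  convert! h using 2 with k
  have h1 : ∀ m, (-(t ^ 2 * P * ‖c m‖ ^ 2 / (4 * r₀ ^ η))) ^ (k : ℕ) =
      (-1 : ℝ) ^ (k : ℕ) * t ^ (2 * (k : ℕ)) * (P / (4 * r₀ ^ η)) ^ (k : ℕ) *
        ‖c m‖ ^ (2 * (k : ℕ)) := by
    intro m
    rw [pow_mul, pow_mul, ← mul_pow, ← mul_pow, ← mul_pow]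
    congr 1
    ring
  simp only [h1, ← Finset.sum_div, ← Finset.mul_sum]
  rw [symbolMoment_eq]
  ring

/-- The Taylor coefficients of the exponent of the characteristic function. -/
noncomputable def interferenceCoeff (lam P η r₀ : ℝ) {M : ℕ} (c : Fin M → ℂ) (n : ℕ) : ℝ :=
  if Even n ∧ n ≠ 0 then
    2 * Real.pi * lam * r₀ ^ 2 * ((-1 : ℝ) ^ (n / 2) * symbolMoment c n /
      ((η * ((n / 2 : ℕ) : ℝ) - 2) * ((n / 2)! : ℝ)) * (P / (4 * r₀ ^ η)) ^ (n / 2))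
  else 0

theorem hasSum_interferenceExponent (hη : 2 < η) (t : ℝ) :
    HasSum (fun n => t ^ n * interferenceCoeff lam P η r₀ c n)
      (interferenceExponent lam P η r₀ c t) := by
  have hinj : Function.Injective fun k : ℕ+ => 2 * (k : ℕ) := fun a b hab =>
    PNat.eq (Nat.eq_of_mul_eq_mul_left two_pos hab)
  rw [← hinj.hasSum_iff, interferenceExponent_eq]
  · have h := (hasSum_interferenceExponent_pnat (P := P) (r₀ := r₀) (c := c) hη t).mul_left
      (2 * Real.pi * lam * r₀ ^ 2)
    convert! h using 2 with k
    simp only [Function.comp_apply]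
    rw [interferenceCoeff, if_pos ⟨even_two_mul _, by simp⟩,
      Nat.mul_div_cancel_left _ two_pos]
    ring
  · intro n hn
    rw [interferenceCoeff, if_neg, mul_zero]
    rintro ⟨⟨k, rfl⟩, h0⟩
    exact hn ⟨⟨k, by omega⟩, by simp [two_mul]⟩

theorem hasSum_ofReal_interferenceExponent (hη : 2 < η) (t : ℝ) :
    HasSum (fun n => (t : ℂ) ^ n * (interferenceCoeff lam P η r₀ c n : ℂ))
      (interferenceExponent lam P η r₀ c t : ℂ) := by
  have h := Complex.hasSum_ofReal.2 (hasSum_interferenceExponent (lam := lam) (P := P) (r₀ := r₀)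
    (c := c) hη t)
  simpa only [Complex.ofReal_mul, Complex.ofReal_pow] using h

/-- For `n = 2k` the descending factorial is `(2k)! / k!`, the sign `(-1) ^ k` cancels against `I ^
(2k)`, and `2 ^ (n - 1) = 4 ^ k / 2` absorbs the remaining constants. -/
theorem factorial_mul_interferenceCoeff_div (hr₀ : 0 < r₀) {n : ℕ} (hn : Even n) (h0 : n ≠ 0) :
    (n ! : ℂ) * (interferenceCoeff lam P η r₀ c n : ℂ) / Complex.I ^ n =
      ((Real.pi * lam * P ^ (n / 2) * (n.descFactorial (n / 2) : ℝ) /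
        (2 ^ (n - 1) * (η * (n : ℝ) / 2 - 2)) * r₀ ^ (2 - η * (n : ℝ) / 2) *
          symbolMoment c n : ℝ) : ℂ) := by
  rw [interferenceCoeff, if_pos ⟨hn, h0⟩]
  obtain ⟨k, rfl⟩ := hn
  rw [← two_mul] at h0 ⊢
  have hk : 0 < k := by omega
  rw [Nat.mul_div_cancel_left _ two_pos, pow_mul, Complex.I_sq]
  have h1 : ((2 * k)! : ℝ) = (k ! : ℝ) * ((2 * k).descFactorial k : ℝ) := by
    rw [← Nat.cast_mul, ← Nat.factorial_mul_descFactorial (show k ≤ 2 * k by omega)]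
    congr 3
    omega
  have h2 : r₀ ^ (2 - η * ((2 * k : ℕ) : ℝ) / 2) = r₀ ^ 2 * ((r₀ ^ η) ^ k)⁻¹ := by
    rw [show 2 - η * ((2 * k : ℕ) : ℝ) / 2 = ((2 : ℕ) : ℝ) - η * (k : ℝ) by push_cast; ring,
      Real.rpow_sub hr₀, Real.rpow_mul hr₀.le, Real.rpow_natCast, Real.rpow_natCast,
      div_eq_mul_inv]
  have h3 : (2 : ℝ) ^ (2 * k - 1) = 4 ^ k / 2 := by
    rw [eq_div_iff two_ne_zero, ← pow_succ, show 2 * k - 1 + 1 = 2 * k by omega, pow_mul]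
    norm_num
  have h4 : η * ((2 * k : ℕ) : ℝ) / 2 - 2 = η * k - 2 := by push_cast; ring
  have h5 : ((-1 : ℝ) ^ k) * (-1) ^ k = 1 := by rw [← mul_pow]; norm_num
  rw [h2, h3, h4, div_eq_iff (by simp)]
  have key : ((2 * k)! : ℝ) * (2 * Real.pi * lam * r₀ ^ 2 * ((-1 : ℝ) ^ k * symbolMoment c (2 * k) /
      ((η * (k : ℝ) - 2) * (k ! : ℝ)) * (P / (4 * r₀ ^ η)) ^ k)) =
      Real.pi * lam * P ^ k * ((2 * k).descFactorial k : ℝ) / (4 ^ k / 2 * (η * k - 2)) *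
        (r₀ ^ 2 * ((r₀ ^ η) ^ k)⁻¹) * symbolMoment c (2 * k) * (-1) ^ k := by
    have hk0 : (k ! : ℝ) ≠ 0 := by positivity
    rw [h1, div_pow, mul_pow]
    field_simp
  exact_mod_cast key

end Exponent

/-! ### Separating locations and marks -/

theorem partialInterference_eq {Ω : Type*} (P η : ℝ) (x : ℕ → Ω → Plane) (s h : ℕ → Ω → ℂ)
    (N : ℕ) (ω : Ω) : partialInterference P η x s h N ω =
      ∑ k ∈ Finset.range N, (pathGain P η (x k ω) : ℂ) * (s k ω * h k ω) := by
  refine Finset.sum_congr rfl fun k _ => ?_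
  rw [pathGain]
  push_cast
  ring

/-- The interference of the first `N` interferers as a function of the locations and the marks. -/
noncomputable def markedSum (P η : ℝ) (N : ℕ) (p : (ℕ → Plane) × (ℕ ⊕ ℕ → ℂ)) : ℂ :=
  ∑ k ∈ Finset.range N, (pathGain P η (p.1 k) : ℂ) * (p.2 (Sum.inl k) * p.2 (Sum.inr k))

theorem measurable_markedSum (P η : ℝ) (N : ℕ) : Measurable (markedSum P η N) := by
  unfold markedSum
  have := measurable_pathGain P η
  fun_prop

section Marks

variable {Ω : Type*} [MeasurableSpace Ω] {μ : Measure Ω} {M : ℕ}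
  {c : Fin M → ℂ} {s h : ℕ → Ω → ℂ}

theorem aemeasurable_sumElim (hs : ∀ k, HasLaw (s k) (symbolLaw c) μ)
    (hh : ∀ k, HasLaw (h k) stdComplexGaussian μ) (j : ℕ ⊕ ℕ) :
    AEMeasurable (Sum.elim s h j) μ := by
  rcases j with k | k
  · exact (hs k).aemeasurable
  · exact (hh k).aemeasurable

/-- Reindexing the marks by `ℕ × Bool` puts symbol and fading of one interferer into one group;
functions of disjoint groups are independent. -/
theorem iIndepFun_symbol_mul (hs : ∀ k, HasLaw (s k) (symbolLaw c) μ)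
    (hh : ∀ k, HasLaw (h k) stdComplexGaussian μ) (hmarks : iIndepFun (Sum.elim s h) μ) :
    iIndepFun (fun k ω => s k ω * h k ω) μ := by
  let e : ℕ × Bool → ℕ ⊕ ℕ := fun p => cond p.2 (Sum.inr p.1) (Sum.inl p.1)
  have he : Function.Injective e := by
    rintro ⟨a, _ | _⟩ ⟨b, _ | _⟩ hab <;> simp_all [e]
  have h1 := (hmarks.precomp he).curry fun p => aemeasurable_sumElim hs hh (e p)
  exact h1.comp (fun _ v => v false * v true) fun _ => by fun_prop

theorem indepFun_symbol_fading (hmarks : iIndepFun (Sum.elim s h) μ) (k : ℕ) :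
    IndepFun (s k) (h k) μ :=
  hmarks.indepFun (i := Sum.inl k) (j := Sum.inr k) (by simp)

end Marks

/-! ### Convergence and characteristic function of the interference -/

section Interference

variable {Ω : Type*} [MeasurableSpace Ω] {μ : Measure Ω}
  {lam P η r₀ : ℝ} {M : ℕ} {c : Fin M → ℂ} {x : ℕ → Ω → Plane} {s h : ℕ → Ω → ℂ}

/-- For almost every frozen configuration the squared gains are summable, so the one-series theorem
applies to the marks; independence carries the conclusion back to the joint law. -/
theorem ae_tendsto_partialInterference [IsProbabilityMeasure μ] (hP : 0 < P) (hη : 2 < η)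
    (hr₀ : 0 < r₀) (hc : symbolMoment c 2 = 1)
    (hx : IsPoissonPointProcess μ (exteriorIntensity lam r₀) x)
    (hs : ∀ k, HasLaw (s k) (symbolLaw c) μ) (hh : ∀ k, HasLaw (h k) stdComplexGaussian μ)
    (hmarks : iIndepFun (Sum.elim s h) μ)
    (hindep : IndepFun (fun ω (k : ℕ) => x k ω) (fun ω (j : ℕ ⊕ ℕ) => Sum.elim s h j ω) μ) :
    ∀ᵐ ω ∂μ, Tendsto (fun N => partialInterference P η x s h N ω) atTop
      (𝓝 (aggregateInterference P η x s h ω)) := by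
  have hC : MeasurableSet {p | ∃ l, Tendsto (fun N => markedSum P η N p) atTop (𝓝 l)} :=
    measurableSet_exists_tendsto (measurable_markedSum P η)
  have hae := hindep.ae_of_ae_ae (measurable_pi_lambda _ hx.measurable).aemeasurable
    (aemeasurable_pi_iff.2 (aemeasurable_sumElim hs hh)) hC ?_
  · filter_upwards [hae] with ω hω
    refine tendsto_nhds_limUnder ?_
    obtain ⟨l, hl⟩ := hω
    exact ⟨l, hl.congr fun N => (partialInterference_eq P η x s h N ω).symm⟩
  · have hM := pos_of_symbolMoment_two_eq_one hc
    filter_upwards [hx.ae_summable (fun R => exteriorIntensity_ball_ne_top lam r₀ R)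
      ((measurable_pathGain P η).pow_const 2) (integrable_pathGain_sq hP.le hη hr₀)] with ω hω
    have hae := ae_exists_tendsto_sum_mul (fun k => memLp_symbol_mul hM (hs k) (hh k))
      (iIndepFun_symbol_mul hs hh hmarks)
      (fun k => integral_symbol_mul (hs k) (hh k) (indepFun_symbol_fading hmarks k))
      (fun k => (integral_norm_sq_symbol_mul (hs k) (hh k)
        (indepFun_symbol_fading hmarks k)).le) hω
    filter_upwards [hae] with ω' hω'
    exact hω'

theorem aemeasurable_partialInterference (hx : IsPoissonPointProcess μ (exteriorIntensity lam r₀) x)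
    (hs : ∀ k, HasLaw (s k) (symbolLaw c) μ) (hh : ∀ k, HasLaw (h k) stdComplexGaussian μ) (N : ℕ) :
    AEMeasurable (partialInterference P η x s h N) μ := by
  rw [funext (partialInterference_eq P η x s h N)]
  refine Finset.aemeasurable_fun_sum _ fun k _ => ?_
  exact (Complex.measurable_ofReal.comp
    ((measurable_pathGain P η).comp (hx.measurable k))).aemeasurable.mul
      ((hs k).aemeasurable.mul (hh k).aemeasurable)

/-- The characteristic function of the partial interference, given the locations. -/
theorem charFun_partialInterference [IsProbabilityMeasure μ]
    (hx : IsPoissonPointProcess μ (exteriorIntensity lam r₀) x)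
    (hs : ∀ k, HasLaw (s k) (symbolLaw c) μ) (hh : ∀ k, HasLaw (h k) stdComplexGaussian μ)
    (hmarks : iIndepFun (Sum.elim s h) μ)
    (hindep : IndepFun (fun ω (k : ℕ) => x k ω) (fun ω (j : ℕ ⊕ ℕ) => Sum.elim s h j ω) μ)
    (N : ℕ) (w : ℂ) :
    charFun (μ.map (partialInterference P η x s h N)) w =
      ((∫ ω, ∏ k ∈ Finset.range N, fadedCharFun c (pathGain P η (x k ω) * ‖w‖) ∂μ : ℝ) : ℂ) := by
  have hm := aemeasurable_partialInterference (P := P) (η := η) hx hs hh N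
  have hF : StronglyMeasurable fun p => Complex.exp
      ((inner ℝ (markedSum P η N p) w : ℝ) * Complex.I) := by
    have := measurable_markedSum P η N
    refine Measurable.stronglyMeasurable ?_
    fun_prop
  have hXm : AEMeasurable (fun ω (k : ℕ) => x k ω) μ :=
    (measurable_pi_lambda _ hx.measurable).aemeasurable
  have hYm : AEMeasurable (fun ω (j : ℕ ⊕ ℕ) => Sum.elim s h j ω) μ :=
    aemeasurable_pi_iff.2 (aemeasurable_sumElim hs hh)
  have hWm : ∀ k, AEMeasurable (fun ω => s k ω * h k ω) μ := fun k =>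
    (hs k).aemeasurable.mul (hh k).aemeasurable
  rw [charFun_apply, integral_map hm (by fun_prop)]
  have h1 : ∀ ω, partialInterference P η x s h N ω = markedSum P η N
      ((fun k => x k ω), fun j => Sum.elim s h j ω) := partialInterference_eq P η x s h N
  simp only [h1]
  rw [hindep.integral_prod_eq hXm hYm hF, ← integral_complex_ofReal]
  · refine integral_congr_ae (ae_of_all _ fun ω => ?_)
    have h2 := charFun_map_sum_mul hWm (iIndepFun_symbol_mul hs hh hmarks)
      (fun k => pathGain P η (x k ω)) N w
    rw [charFun_apply, integral_map (Finset.aemeasurable_fun_sum _ fun k _ =>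
      (hWm k).const_mul _) (by fun_prop)] at h2
    refine h2.trans ?_
    simp only
    rw [Complex.ofReal_prod]
    refine Finset.prod_congr rfl fun k _ => ?_
    rw [charFun_map_symbol_mul (hs k) (hh k) (indepFun_symbol_fading hmarks k), norm_mul,
      Complex.norm_real, fadedCharFun, fadedCharFun]
    simp only [mul_pow, Real.norm_eq_abs, sq_abs]
  · refine Integrable.of_bound (C := 1) (hF.measurable.comp_aemeasurable
      (hXm.prodMk hYm)).aestronglyMeasurable (ae_of_all _ fun ω => ?_)
    rw [Complex.norm_exp_ofReal_mul_I]

/-- The characteristic function of the aggregate interference. -/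
theorem charFun_aggregateInterference [IsProbabilityMeasure μ] (hlam : 0 < lam) (hP : 0 < P)
    (hη : 2 < η) (hr₀ : 0 < r₀) (hc : symbolMoment c 2 = 1)
    (hx : IsPoissonPointProcess μ (exteriorIntensity lam r₀) x)
    (hs : ∀ k, HasLaw (s k) (symbolLaw c) μ) (hh : ∀ k, HasLaw (h k) stdComplexGaussian μ)
    (hmarks : iIndepFun (Sum.elim s h) μ)
    (hindep : IndepFun (fun ω (k : ℕ) => x k ω) (fun ω (j : ℕ ⊕ ℕ) => Sum.elim s h j ω) μ)
    (w : ℂ) :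
    charFun (μ.map (aggregateInterference P η x s h)) w =
      ((Real.exp (interferenceExponent lam P η r₀ c ‖w‖) : ℝ) : ℂ) := by
  have hconv := ae_tendsto_partialInterference hP hη hr₀ hc hx hs hh hmarks hindep
  have hpm := fun N => aemeasurable_partialInterference (P := P) (η := η) hx hs hh N
  have hm : AEMeasurable (aggregateInterference P η x s h) μ :=
    aemeasurable_of_tendsto_metrizable_ae atTop hpm hconv
  have hball := fun R : ℕ => exteriorIntensity_ball_ne_top lam r₀ R
  -- Chosen so that the conditional characteristic function, a product over the points, is `exp` of
  -- minus a sum over the points.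
  set f : Plane → ℝ := fun y => -Real.log (fadedCharFun c (pathGain P η y * ‖w‖)) with hf
  have hfm : Measurable f := ((measurable_fadedCharFun.comp
    ((measurable_pathGain P η).mul_const _)).log).neg
  have hf0 : ∀ y, 0 ≤ f y := fun y => neg_log_fadedCharFun_nonneg hc _
  have hfi : Integrable f (exteriorIntensity lam r₀) := by
    refine (((integrable_pathGain_sq hP.le hη hr₀).mul_const (‖w‖ ^ 2)).div_const 4).mono'
      hfm.aestronglyMeasurable (ae_of_all _ fun y => ?_)
    rw [Real.norm_of_nonneg (hf0 y), ← mul_pow]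
    exact neg_log_fadedCharFun_le hc _
  have hexp : ∀ y, Real.exp (-f y) = fadedCharFun c (pathGain P η y * ‖w‖) := by
    intro y
    rw [hf, neg_neg, Real.exp_log (fadedCharFun_pos hc _)]
  have hlap := hx.integral_exp_neg_tsum hball hfm hf0 hfi
  simp only [hexp] at hlap
  rw [integral_one_sub_fadedCharFun hlam hP hη hr₀ (pos_of_symbolMoment_two_eq_one hc),
    neg_neg] at hlap
  have hL : Tendsto (fun N => charFun (μ.map (partialInterference P η x s h N)) w) atTop
      (𝓝 (charFun (μ.map (aggregateInterference P η x s h)) w)) := by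
    simp only [charFun_apply]
    rw [integral_map hm (by fun_prop)]
    have h1 : ∀ N, ∫ z, Complex.exp ((inner ℝ z w : ℝ) * Complex.I)
        ∂(μ.map (partialInterference P η x s h N)) =
        ∫ ω, Complex.exp ((inner ℝ (partialInterference P η x s h N ω) w : ℝ) * Complex.I) ∂μ :=
      fun N => integral_map (hpm N) (by fun_prop)
    simp only [h1]
    refine tendsto_integral_of_dominated_convergence (fun _ => 1) (fun N => ?_)
      (integrable_const _) (fun N => ae_of_all _ fun ω => ?_) ?_
    · exact (Measurable.comp_aemeasurable
        (g := fun z : ℂ => Complex.exp ((inner ℝ z w : ℝ) * Complex.I))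
        (by fun_prop) (hpm N)).aestronglyMeasurable
    · rw [Complex.norm_exp_ofReal_mul_I]
    · filter_upwards [hconv] with ω hω
      exact (Continuous.tendsto (f := fun z : ℂ => Complex.exp ((inner ℝ z w : ℝ) * Complex.I))
        (by fun_prop) _).comp hω
  -- The conditional products lie in `[0, 1]` and converge almost surely to `exp(-∑ f (x k))`, whose
  -- mean is the Laplace functional.
  have hR : Tendsto (fun N => charFun (μ.map (partialInterference P η x s h N)) w) atTop
      (𝓝 ((Real.exp (interferenceExponent lam P η r₀ c ‖w‖) : ℝ) : ℂ)) := by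
    simp only [charFun_partialInterference hx hs hh hmarks hindep]
    refine (Complex.continuous_ofReal.tendsto _).comp ?_
    rw [← hlap]
    refine tendsto_integral_of_dominated_convergence (fun _ => 1) (fun N => ?_)
      (integrable_const _) (fun N => ae_of_all _ fun ω => ?_) ?_
    · exact (Finset.measurable_prod _ fun k _ => measurable_fadedCharFun.comp
        (((measurable_pathGain P η).comp (hx.measurable k)).mul_const _)).aestronglyMeasurable
    · rw [Real.norm_of_nonneg (Finset.prod_nonneg fun k _ => (fadedCharFun_pos hc _).le)]
      exact Finset.prod_le_one (fun k _ => (fadedCharFun_pos hc _).le)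
        fun k _ => fadedCharFun_le_one _
    · filter_upwards [hx.ae_summable hball hfm hfi] with ω hω
      refine ((Real.continuous_exp.tendsto _).comp hω.hasSum.tendsto_sum_nat.neg).congr fun N => ?_
      simp only [Function.comp_apply]
      rw [← Finset.sum_neg_distrib, Real.exp_sum]
      exact Finset.prod_congr rfl fun k _ => hexp _
  exact tendsto_nhds_unique hL hR

end Interference

/-! ### Characteristic functions of projections and rotations -/

section Marginals

variable {Ω : Type*} [MeasurableSpace Ω] {μ : Measure Ω} {Z : Ω → ℂ}

theorem charFun_map_re (hZ : AEMeasurable Z μ) (t : ℝ) :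
    charFun (μ.map fun ω => (Z ω).re) t = charFun (μ.map Z) (t : ℂ) := by
  have hre : AEMeasurable (fun ω => (Z ω).re) μ := Complex.measurable_re.comp_aemeasurable hZ
  rw [charFun_apply, charFun_apply, integral_map hZ (by fun_prop),
    integral_map hre (by fun_prop)]
  simp [Complex.inner, mul_comm]

theorem charFun_map_im (hZ : AEMeasurable Z μ) (t : ℝ) :
    charFun (μ.map fun ω => (Z ω).im) t = charFun (μ.map Z) (t * Complex.I) := by
  have him : AEMeasurable (fun ω => (Z ω).im) μ := Complex.measurable_im.comp_aemeasurable hZ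
  rw [charFun_apply, charFun_apply, integral_map hZ (by fun_prop),
    integral_map him (by fun_prop)]
  simp [Complex.inner, mul_comm]

theorem charFun_map_const_mul (hZ : AEMeasurable Z μ) (u w : ℂ) :
    charFun (μ.map fun ω => u * Z ω) w = charFun (μ.map Z) (starRingEnd ℂ u * w) := by
  rw [charFun_apply, charFun_apply, integral_map hZ (by fun_prop),
    integral_map (hZ.const_mul u) (by fun_prop)]
  refine integral_congr_ae (ae_of_all _ fun ω => ?_)
  simp only [Complex.inner, map_mul]
  congr 4
  ring

end Marginals

/-! ### Cumulants and power per dimension -/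

section Cumulants

variable {Ω : Type*} [MeasurableSpace Ω] {μ : Measure Ω}
  {lam P η r₀ : ℝ} {M : ℕ} {c : Fin M → ℂ} {X : Ω → ℝ}

theorem interferenceExponent_abs (t : ℝ) :
    interferenceExponent lam P η r₀ c |t| = interferenceExponent lam P η r₀ c t := by
  simp only [interferenceExponent, sq_abs]

/-- The characteristic function is a positive real at every `t`, so the principal logarithm recovers
the exponent globally, not just near `0`. -/
theorem logCharFun_eq (hφ : ∀ t, charFun (μ.map X) t =
      ((Real.exp (interferenceExponent lam P η r₀ c t) : ℝ) : ℂ)) :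
    logCharFun μ X = fun t => (interferenceExponent lam P η r₀ c t : ℂ) := by
  funext t
  rw [logCharFun, hφ, ← Complex.ofReal_log (Real.exp_nonneg _), Real.log_exp]

theorem cumulant_eq (hη : 2 < η) (hφ : ∀ t, charFun (μ.map X) t =
      ((Real.exp (interferenceExponent lam P η r₀ c t) : ℝ) : ℂ)) (n : ℕ) :
    cumulant μ X n = (n ! : ℂ) * (interferenceCoeff lam P η r₀ c n : ℂ) / Complex.I ^ n := by
  rw [cumulant, logCharFun_eq hφ,
    iteratedDeriv_zero_of_hasSum (hasSum_ofReal_interferenceExponent hη)]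

/-- Since `1 - exp E ≤ -E = O(t²)`, the variable is square-integrable; its second moment is then the
second cumulant, evaluated with unit symbol power. -/
theorem memLp_two_and_integral_sq [IsProbabilityMeasure μ] (hlam : 0 < lam) (hP : 0 < P)
    (hη : 2 < η) (hr₀ : 0 < r₀) (hc : symbolMoment c 2 = 1) (hX : AEMeasurable X μ)
    (hφ : ∀ t, charFun (μ.map X) t =
      ((Real.exp (interferenceExponent lam P η r₀ c t) : ℝ) : ℂ)) :
    MemLp X 2 μ ∧ ∫ ω, X ω ^ 2 ∂μ = Real.pi * lam * P * r₀ ^ (2 - η) / (η - 2) := by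
  have hmem : MemLp X 2 μ := by
    refine memLp_two_of_charFun_le hX
      (C := ∫ y, pathGain P η y ^ 2 / 4 ∂(exteriorIntensity lam r₀)) fun t => ?_
    rw [hφ, Complex.ofReal_re]
    have h1 := neg_interferenceExponent_le hlam hP hη hr₀ hc t
    have h2 := Real.add_one_le_exp (interferenceExponent lam P η r₀ c t)
    linarith
  refine ⟨hmem, ?_⟩
  have hsum := hasSum_ofReal_interferenceExponent (lam := lam) (P := P) (r₀ := r₀) (c := c) hη
  have hd := iteratedDeriv_zero_of_hasSum hsum
  have h0 : (interferenceExponent lam P η r₀ c 0 : ℂ) = 0 := by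
    have := hd 0
    simpa [interferenceCoeff] using this
  have h1 : deriv (fun t => (interferenceExponent lam P η r₀ c t : ℂ)) 0 = 0 := by
    have := hd 1
    simpa [interferenceCoeff] using this
  have h2 := integral_sq_eq_neg_iteratedDeriv hmem (contDiff_of_hasSum hsum 2)
    (fun t => by rw [hφ, Complex.ofReal_exp]) h0 h1
  have h3 := factorial_mul_interferenceCoeff_div (lam := lam) (P := P) (η := η) (c := c) hr₀
    even_two two_ne_zero
  rw [← hd 2, Complex.I_sq, div_neg, div_one, ← h2] at h3
  rw [Complex.ofReal_injective h3, hc]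
  norm_num
  have : η - 2 ≠ 0 := by linarith
  field_simp

end Cumulants

/-! ### The main theorem -/

theorem mainTheorem5 {Ω : Type*} [MeasurableSpace Ω] (μ : Measure Ω) [IsProbabilityMeasure μ]
    (lam P η r₀ : ℝ) (hlam : 0 < lam) (hP : 0 < P) (hη : 2 < η) (hr₀ : 0 < r₀)
    (M : ℕ) (c : Fin M → ℂ) (hc : symbolMoment c 2 = 1)
    (x : ℕ → Ω → Plane) (s h : ℕ → Ω → ℂ)
    -- the interferers form a Poisson process outside the disc, enumerated by distance
    (hx : IsPoissonPointProcess μ (exteriorIntensity lam r₀) x)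
    (hmono : ∀ᵐ ω ∂μ, Monotone (fun k => ‖x k ω‖))
    -- equiprobable symbols and Rayleigh fading, all independent, and independent of the locations
    (hs : ∀ k, HasLaw (s k) (symbolLaw c) μ)
    (hh : ∀ k, HasLaw (h k) stdComplexGaussian μ)
    (hmarks : iIndepFun (Sum.elim s h) μ)
    (hindep : IndepFun (fun ω (k : ℕ) => x k ω) (fun ω (j : ℕ ⊕ ℕ) => Sum.elim s h j ω) μ) :
    -- the aggregate interference is a well-defined random variable
    (∀ᵐ ω ∂μ, Tendsto (fun N => partialInterference P η x s h N ω) atTop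
      (𝓝 (aggregateInterference P η x s h ω))) ∧
    AEMeasurable (aggregateInterference P η x s h) μ ∧
    -- circular symmetry
    (∀ u : ℂ, ‖u‖ = 1 →
      μ.map (fun ω => u * aggregateInterference P η x s h ω) =
        μ.map (aggregateInterference P η x s h)) ∧
    -- characteristic function, hypergeometric form
    (∀ w : ℂ, charFun (μ.map (aggregateInterference P η x s h)) w =
      ((Real.exp (Real.pi * lam / M * ∑ m : Fin M, r₀ ^ 2 *
        (1 - kummer (-(2 / η)) (1 - 2 / η)
          (-(‖w‖ ^ 2 * P * ‖c m‖ ^ 2 / (4 * r₀ ^ η))))) : ℝ) : ℂ)) ∧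
    -- characteristic function, power series form
    (∀ w : ℂ,
      Summable (fun k : ℕ+ => (-1 : ℝ) ^ (k : ℕ) * ‖w‖ ^ (2 * (k : ℕ)) *
        symbolMoment c (2 * (k : ℕ)) / ((η * ((k : ℕ) : ℝ) - 2) * ((k : ℕ)! : ℝ)) *
          (P / (4 * r₀ ^ η)) ^ (k : ℕ)) ∧
      charFun (μ.map (aggregateInterference P η x s h)) w =
        ((Real.exp (2 * Real.pi * lam * r₀ ^ 2 *
          ∑' k : ℕ+, (-1 : ℝ) ^ (k : ℕ) * ‖w‖ ^ (2 * (k : ℕ)) *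
            symbolMoment c (2 * (k : ℕ)) / ((η * ((k : ℕ) : ℝ) - 2) * ((k : ℕ)! : ℝ)) *
              (P / (4 * r₀ ^ η)) ^ (k : ℕ)) : ℝ) : ℂ)) ∧
    -- the cumulants per dimension exist and are explicit
    (∀ X : Ω → ℝ,
      (X = (fun ω => (aggregateInterference P η x s h ω).re) ∨
        X = (fun ω => (aggregateInterference P η x s h ω).im)) →
      ContDiffAt ℝ ((⊤ : ℕ∞) : WithTop ℕ∞) (logCharFun μ X) 0 ∧
      ∀ n : ℕ, 1 ≤ n →
        (Odd n → cumulant μ X n = 0) ∧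
        (Even n → cumulant μ X n =
          ((Real.pi * lam * P ^ (n / 2) * (n.descFactorial (n / 2) : ℝ) /
            (2 ^ (n - 1) * (η * (n : ℝ) / 2 - 2)) * r₀ ^ (2 - η * (n : ℝ) / 2) *
              symbolMoment c n : ℝ) : ℂ))) ∧
    -- the expected interference power
    Integrable (fun ω => ‖aggregateInterference P η x s h ω‖ ^ 2) μ ∧
    ∫ ω, ‖aggregateInterference P η x s h ω‖ ^ 2 ∂μ =
      2 * Real.pi * lam * P * r₀ ^ (2 - η) / (η - 2) := by
  have hconv := ae_tendsto_partialInterference hP hη hr₀ hc hx hs hh hmarks hindep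
  have hm : AEMeasurable (aggregateInterference P η x s h) μ :=
    aemeasurable_of_tendsto_metrizable_ae atTop
      (fun N => aemeasurable_partialInterference (P := P) (η := η) hx hs hh N) hconv
  have hφ := charFun_aggregateInterference hlam hP hη hr₀ hc hx hs hh hmarks hindep
  -- The two marginals evaluate the planar characteristic function at `t` and `t * I`, both of
  -- modulus `|t|`, so they have the same law.
  have hre : ∀ t, charFun (μ.map fun ω => (aggregateInterference P η x s h ω).re) t =
      ((Real.exp (interferenceExponent lam P η r₀ c t) : ℝ) : ℂ) := by
    intro t
    rw [charFun_map_re hm, hφ, Complex.norm_real, Real.norm_eq_abs, interferenceExponent_abs]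
  have him : ∀ t, charFun (μ.map fun ω => (aggregateInterference P η x s h ω).im) t =
      ((Real.exp (interferenceExponent lam P η r₀ c t) : ℝ) : ℂ) := by
    intro t
    rw [charFun_map_im hm, hφ, norm_mul, Complex.norm_I, mul_one, Complex.norm_real,
      Real.norm_eq_abs, interferenceExponent_abs]
  have hrem : AEMeasurable (fun ω => (aggregateInterference P η x s h ω).re) μ :=
    Complex.measurable_re.comp_aemeasurable hm
  have himm : AEMeasurable (fun ω => (aggregateInterference P η x s h ω).im) μ :=
    Complex.measurable_im.comp_aemeasurable hm
  obtain ⟨hre2, hreI⟩ := memLp_two_and_integral_sq hlam hP hη hr₀ hc hrem hre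
  obtain ⟨him2, himI⟩ := memLp_two_and_integral_sq hlam hP hη hr₀ hc himm him
  have hnorm : ∀ ω, ‖aggregateInterference P η x s h ω‖ ^ 2 =
      (aggregateInterference P η x s h ω).re ^ 2 + (aggregateInterference P η x s h ω).im ^ 2 := by
    intro ω
    rw [Complex.sq_norm, Complex.normSq_apply]
    ring
  refine ⟨hconv, hm, fun u hu => ?_, fun w => ?_, fun w => ⟨?_, ?_⟩, fun X hX => ?_, ?_, ?_⟩
  -- Rotation by `u` replaces `w` by a point of equal modulus, and the characteristic function is
  -- radial.
  · have := Measure.isProbabilityMeasure_map hm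
    have := Measure.isProbabilityMeasure_map (hm.const_mul u)
    refine Measure.ext_of_charFun (funext fun w => ?_)
    rw [charFun_map_const_mul hm, hφ, hφ, norm_mul, RCLike.norm_conj, hu, one_mul]
  · rw [hφ, interferenceExponent]
  · exact (hasSum_interferenceExponent_pnat hη ‖w‖).summable
  · rw [hφ, (hasSum_interferenceExponent_pnat hη ‖w‖).tsum_eq, interferenceExponent_eq]
  · have hX' : ∀ t, charFun (μ.map X) t =
        ((Real.exp (interferenceExponent lam P η r₀ c t) : ℝ) : ℂ) := by
      rcases hX with rfl | rfl
      · exact hre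
      · exact him
    refine ⟨?_, fun n hn => ⟨fun hodd => ?_, fun heven => ?_⟩⟩
    · rw [logCharFun_eq hX']
      exact (contDiff_of_hasSum (hasSum_ofReal_interferenceExponent hη) _).contDiffAt
    · rw [cumulant_eq hη hX', interferenceCoeff, if_neg fun h' => Nat.not_even_iff_odd.2 hodd h'.1]
      simp
    · rw [cumulant_eq hη hX', factorial_mul_interferenceCoeff_div hr₀ heven (by omega)]
  · simp only [hnorm]
    exact hre2.integrable_sq.add him2.integrable_sq
  · simp only [hnorm]
    rw [integral_add hre2.integrable_sq him2.integrable_sq]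
    rw [hreI, himI]
    ring
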